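/- Let $N\ge 2$ and let $\Omega\subset\mathbb{R}^N$ be a (nonempty) open, connected, bounded set with $C^2$ boundary and outer unit normal $\nu$. Let $\kappa_1,\dots,\kappa_{N-1}$ be the principal curvatures of $\partial\Omega$, i.e. the eigenvalues of the differential $\nabla\nu$ of $\nu$ on the tangent spaces of $\partial\Omega$ (so that balls have positive curvatures), and put $$\kappa_{\min}=\min_{x\in\partial\Omega}\ \min_{1\le i\le N-1}\kappa_i(x).$$ Let $\beta\in\mathbb{R}\setminus\{0\}$ and let $u\in C^2(\overline\Omega)$ be a solution of the overdetermined problem $$\begin{cases}\Delta u=N&\text{in }\Omega,\\[2pt] \dfrac{\partial u}{\partial\nu}+\beta u=0&\text{on }\partial\Omega,\\[4pt] \langle\nabla^2u\,\nu,\nu\rangle=1&\text{on }\partial\Omega.\end{cases}$$ If $\kappa_{\min}+\beta>0$, then $\Omega$ is a ball and $u$ is radially symmetric about its centre. -/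

import Mathlib

open Set Filter Topology
open scoped RealInnerProductSpace

noncomputable section

namespace RobinTorsion

/-- The Euclidean space `ℝ^N`. -/
abbrev Euc (N : ℕ) : Type := EuclideanSpace ℝ (Fin N)

variable {N : ℕ}

/-- `φ` is a `C²` defining function of `Ω` on the open set `U`: it has no critical point in `U`, and
inside `U` the set `Ω` is the sublevel set `{φ < 0}`. -/
structure IsC2DefiningFunctionOn (Ω U : Set (Euc N)) (φ : Euc N → ℝ) : Prop where
  isOpen : IsOpen U
  contDiffOn : ContDiffOn ℝ 2 φ U
  gradient_ne_zero : ∀ y ∈ U, gradient φ y ≠ 0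
  mem_iff : ∀ y ∈ U, (y ∈ Ω ↔ φ y < 0)

/-- The boundary of `Ω` is of class `C²`: near each of its points, `Ω` has a `C²` defining
function (equivalently, up to a rotation, `Ω` is locally the region below a `C²` graph). -/
def HasC2Boundary (Ω : Set (Euc N)) : Prop :=
  ∀ x ∈ frontier Ω, ∃ (U : Set (Euc N)) (φ : Euc N → ℝ),
    x ∈ U ∧ IsC2DefiningFunctionOn Ω U φ

/-- `n` is the outer unit normal to `Ω` at `x`: the directions making an obtuse angle with `n` enter
`Ω`, and those making an acute angle with `n` leave its closure. There is at most one such `n`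
(`IsOuterUnitNormal.unique`), and on a `C²` boundary it is the normalized gradient of any
defining function (`IsC2DefiningFunctionOn.isOuterUnitNormal`). -/
structure IsOuterUnitNormal (Ω : Set (Euc N)) (x n : Euc N) : Prop where
  norm_eq_one : ‖n‖ = 1
  enters : ∀ v : Euc N, ⟪v, n⟫ < 0 → ∀ᶠ t : ℝ in 𝓝[>] 0, x + t • v ∈ Ω
  leaves : ∀ v : Euc N, 0 < ⟪v, n⟫ → ∀ᶠ t : ℝ in 𝓝[>] 0, x + t • v ∉ closure Ω

open Classical in
/-- The outer unit normal field `ν` of `Ω` (with the value `0` where there is none). -/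
def outerNormal (Ω : Set (Euc N)) (x : Euc N) : Euc N :=
  if h : ∃ n, IsOuterUnitNormal Ω x n then h.choose else 0

theorem IsOuterUnitNormal.unique {Ω : Set (Euc N)} {x n m : Euc N}
    (hn : IsOuterUnitNormal Ω x n) (hm : IsOuterUnitNormal Ω x m) : n = m := by
  by_contra hne
  have h1 : ⟪n, n⟫ = (1 : ℝ) := by rw [real_inner_self_eq_norm_sq, hn.norm_eq_one]; norm_num
  have h2 : ⟪m, m⟫ = (1 : ℝ) := by rw [real_inner_self_eq_norm_sq, hm.norm_eq_one]; norm_num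
  have h3 : 0 < ⟪m - n, m - n⟫ :=
    real_inner_self_pos.2 (sub_ne_zero.2 (Ne.symm hne))
  have h4 : ⟪m, n⟫ = ⟪n, m⟫ := real_inner_comm _ _
  simp only [inner_sub_left, inner_sub_right] at h3
  have ha : ⟪m - n, n⟫ < 0 := by rw [inner_sub_left]; linarith
  have hb : 0 < ⟪m - n, m⟫ := by rw [inner_sub_left]; linarith
  obtain ⟨t, ht1, ht2⟩ := ((hn.enters _ ha).and (hm.leaves _ hb)).exists
  exact ht2 (subset_closure ht1)

theorem IsOuterUnitNormal.outerNormal_eq {Ω : Set (Euc N)} {x n : Euc N}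
    (hn : IsOuterUnitNormal Ω x n) : outerNormal Ω x = n := by
  have h : ∃ n, IsOuterUnitNormal Ω x n := ⟨n, hn⟩
  rw [outerNormal, dif_pos h]
  exact h.choose_spec.unique hn

theorem IsC2DefiningFunctionOn.isOuterUnitNormal {Ω U : Set (Euc N)} {φ : Euc N → ℝ}
    (hφ : IsC2DefiningFunctionOn Ω U φ) (hΩ : IsOpen Ω) {x : Euc N} (hxU : x ∈ U)
    (hx : x ∈ frontier Ω) :
    IsOuterUnitNormal Ω x (‖gradient φ x‖⁻¹ • gradient φ x) := by
  have hU : U ∈ 𝓝 x := hφ.isOpen.mem_nhds hxU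
  have hdiff : DifferentiableAt ℝ φ x :=
    (hφ.contDiffOn.contDiffAt hU).differentiableAt (by norm_num)
  have hg : gradient φ x ≠ 0 := hφ.gradient_ne_zero x hxU
  have hg' : 0 < ‖gradient φ x‖ := norm_pos_iff.2 hg
  have hxΩ : x ∉ Ω := by rw [hΩ.frontier_eq] at hx; exact hx.2
  have hφx : φ x = 0 := by
    refine le_antisymm ?_ (not_lt.1 fun h => hxΩ ((hφ.mem_iff x hxU).2 h))
    by_contra! hpos
    have hev : ∀ᶠ y in 𝓝 x, 0 < φ y := hdiff.continuousAt.eventually (lt_mem_nhds hpos)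
    have hfr : ∃ᶠ y in 𝓝 x, y ∈ Ω := mem_closure_iff_frequently.1 hx.1
    obtain ⟨y, hyΩ, hy, hyU⟩ := (hfr.and_eventually (hev.and hU)).exists
    exact absurd ((hφ.mem_iff y hyU).1 hyΩ) (not_lt.2 hy.le)
  have hline : ∀ v : Euc N, HasDerivAt (fun t : ℝ => φ (x + t • v)) ⟪v, gradient φ x⟫ 0 := by
    intro v
    have h1 : HasDerivAt (fun t : ℝ => x + t • v) v 0 := by
      simpa using ((hasDerivAt_id (0 : ℝ)).smul_const v).const_add x
    have h2 : HasFDerivAt φ (InnerProductSpace.toDual ℝ (Euc N) (gradient φ x))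
        (x + (0 : ℝ) • v) := by
      simpa using hdiff.hasGradientAt.hasFDerivAt
    have h3 := h2.comp_hasDerivAt (0 : ℝ) h1
    have h4 : (InnerProductSpace.toDual ℝ (Euc N) (gradient φ x)) v = ⟪v, gradient φ x⟫ := by
      rw [InnerProductSpace.toDual_apply_apply, real_inner_comm]
    rw [h4] at h3
    exact h3
  have hnear : ∀ v : Euc N, Tendsto (fun t : ℝ => x + t • v) (𝓝[>] 0) (𝓝 x) := by
    intro v
    have : Continuous fun t : ℝ => x + t • v := by fun_prop
    have h := this.tendsto 0
    simp only [zero_smul, add_zero] at h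
    exact h.mono_left nhdsWithin_le_nhds
  have hslope : ∀ v : Euc N,
      Tendsto (fun t : ℝ => t⁻¹ * φ (x + t • v)) (𝓝[>] 0) (𝓝 ⟪v, gradient φ x⟫) := by
    intro v
    have h := (hasDerivAt_iff_tendsto_slope.1 (hline v)).mono_left
      (nhdsWithin_mono (0 : ℝ) (fun t (ht : t ∈ Ioi (0 : ℝ)) => ne_of_gt ht))
    refine h.congr fun t => ?_
    simp [slope_def_field, hφx, div_eq_inv_mul]
  have hsign : ∀ v : Euc N, ⟪v, ‖gradient φ x‖⁻¹ • gradient φ x⟫ =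
      ‖gradient φ x‖⁻¹ * ⟪v, gradient φ x⟫ := fun v => real_inner_smul_right _ _ _
  refine ⟨?_, fun v hv => ?_, fun v hv => ?_⟩
  · rw [norm_smul, norm_inv, norm_norm, inv_mul_cancel₀ hg'.ne']
  · rw [hsign] at hv
    have hv' : ⟪v, gradient φ x⟫ < 0 := by
      by_contra! h
      exact absurd hv (not_lt.2 (by positivity))
    filter_upwards [(hslope v).eventually (gt_mem_nhds hv'), (hnear v).eventually hU,
      self_mem_nhdsWithin] with t h1 h2 (h3 : 0 < t)
    refine (hφ.mem_iff _ h2).2 ?_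
    by_contra! h
    exact absurd h1 (not_lt.2 (by positivity))
  · rw [hsign] at hv
    have hv' : 0 < ⟪v, gradient φ x⟫ := pos_of_mul_pos_right hv (by positivity)
    filter_upwards [(hslope v).eventually (lt_mem_nhds hv'), (hnear v).eventually hU,
      self_mem_nhdsWithin] with t h1 h2 (h3 : 0 < t)
    have hpos : 0 < φ (x + t • v) := pos_of_mul_pos_right h1 (by positivity)
    intro hcl
    have hcont : ContinuousAt φ (x + t • v) :=
      hφ.contDiffOn.continuousOn.continuousAt (hφ.isOpen.mem_nhds h2)
    obtain ⟨y, hyΩ, hy, hyU⟩ := ((mem_closure_iff_frequently.1 hcl).and_eventually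
      ((hcont.eventually (lt_mem_nhds hpos)).and (hφ.isOpen.mem_nhds h2))).exists
    exact absurd ((hφ.mem_iff y hyU).1 hyΩ) (not_lt.2 hy.le)

/-- `κ` is a principal curvature of `∂Ω` at `x`: an eigenvalue of the Weingarten map
`v ↦ D_v ν` on the tangent space `ν(x)^⊥`, where `ν` is the outer unit normal field on `∂Ω`.
On tangent vectors `A` is determined by the values of `ν` on `∂Ω`.
With this sign convex sets have nonnegative curvatures, and a ball of radius `R` has
`κ = 1 / R`. -/
def IsPrincipalCurvature (Ω : Set (Euc N)) (x : Euc N) (κ : ℝ) : Prop :=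
  ∃ A : Euc N →L[ℝ] Euc N, HasFDerivWithinAt (outerNormal Ω) A (frontier Ω) x ∧
    ∃ v : Euc N, v ≠ 0 ∧ ⟪v, outerNormal Ω x⟫ = 0 ∧ A v = κ • v

/-- The least principal curvature `κ_min` over all points of `∂Ω`. -/
def kappaMin (Ω : Set (Euc N)) : ℝ :=
  sInf {κ : ℝ | ∃ x ∈ frontier Ω, IsPrincipalCurvature Ω x κ}

/-- The gradient `∇u` on `closure Ω`, up to the boundary. -/
def grad (Ω : Set (Euc N)) (u : Euc N → ℝ) (x : Euc N) : Euc N :=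
  gradientWithin u (closure Ω) x

/-- The Hessian `∇²u` on `closure Ω`, up to the boundary, as a linear map. -/
def hess (Ω : Set (Euc N)) (u : Euc N → ℝ) (x : Euc N) : Euc N →L[ℝ] Euc N :=
  fderivWithin ℝ (grad Ω u) (closure Ω) x

/-- `u` is a `C²(closure Ω)` solution of the Robin torsion problem with parameter `β`:
`Δu = N` in `Ω` and `∂u/∂ν + β u = 0` on `∂Ω`. -/
structure IsRobinTorsionSolution (Ω : Set (Euc N)) (β : ℝ) (u : Euc N → ℝ) : Prop where
  contDiffOn : ContDiffOn ℝ 2 u (closure Ω)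
  laplacian_eq : ∀ x ∈ Ω, Laplacian.laplacian u x = (N : ℝ)
  robin : ∀ x ∈ frontier Ω, ⟪grad Ω u x, outerNormal Ω x⟫ + β * u x = 0

end RobinTorsion

end

/-! The proof rests on the function `P = |∇u|² - 2u`. Formally `ΔP = 2|∇²u|² - 2N`, and since the
trace of `∇²u` is `N` this equals `2|∇²u - I|² ≥ 0`. So `P` is subharmonic, and it can be constant
only if `∇²u = I`.

At a boundary point let `τ` be the tangential part of `∇u`. Differentiating the Robin condition
along `τ` gives `⟪∇²u ν, τ⟫ = -⟪D_τ ν, τ⟫ - β|τ|²`. Because `⟪∇²u ν, ν⟫ = 1`, the normal derivative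
of `P` is exactly `2⟪∇²u ν, τ⟫`, hence at most `-2(κ_min + β)|τ|² ≤ 0` (`pFunctionDeriv_normal_le`).
Hopf's lemma makes this derivative positive at a boundary maximum of a nonconstant `P`, so `P` is
constant (`pFunction_eq_const`).

Then `∇u = x - z` and `u = |x - z|²/2 + c`. Equality in the boundary estimate gives `τ = 0`, so `x -
z` is normal to the boundary. Its normal component solves a fixed quadratic equation; the bound
`κ_min + β > 0`, used once more, rules out its second root, and the boundary is a sphere
(`eq_ball_of_position_normal`).

As `u` is only `C²`, `P` is only `C¹` and `ΔP` has no classical meaning. Subharmonicity is therefore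
taken in the viscosity sense: `|∇u|²` is replaced by a sum of squared difference quotients, which is
`C²`, and the limit is taken at maximum points (`formal_laplacian_nonpos_of_localMax`). The Hopf
lemma and the strong maximum principle are proved for this weak notion. -/

/-! ### Geometry of a `C²` boundary: tangent cones, curvature, interior balls -/

theorem IsPreconnected.subset_of_disjoint_frontier {X : Type*} [TopologicalSpace X] {s Ω : Set X}
    (hs : IsPreconnected s) (hΩ : IsOpen Ω) (hne : (s ∩ Ω).Nonempty)
    (hd : ∀ y ∈ s, y ∉ frontier Ω) : s ⊆ Ω := by
  refine hs.subset_left_of_subset_union hΩ (isClosed_closure (s := Ω)).isOpen_compl ?_ ?_ hne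
  · exact disjoint_compl_right_iff_subset.2 subset_closure
  · intro y hy
    by_cases hc : y ∈ closure Ω
    · left
      by_contra hn
      exact hd y hy (by rw [hΩ.frontier_eq]; exact ⟨hc, hn⟩)
    · exact Or.inr hc

namespace RobinTorsion

variable {N : ℕ}

theorem IsOuterUnitNormal.inner_self {Ω : Set (Euc N)} {x n : Euc N}
    (hn : IsOuterUnitNormal Ω x n) : ⟪n, n⟫ = (1 : ℝ) := by
  rw [real_inner_self_eq_norm_sq, hn.norm_eq_one]; norm_num

/-- Tilting `v` slightly inwards enters `Ω` and tilting it slightly outwards leaves the closure, so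
the short segment between the two displaced points meets the frontier. This is what permits
differentiating identities that hold only on the frontier. -/
theorem IsOuterUnitNormal.mem_tangentConeAt_frontier {Ω : Set (Euc N)} {x n v : Euc N}
    (hΩ : IsOpen Ω) (hn : IsOuterUnitNormal Ω x n) (hv : ⟪v, n⟫ = (0 : ℝ)) :
    v ∈ tangentConeAt ℝ (frontier Ω) x := by
  have key : ∀ k : ℕ, ∃ t s : ℝ, 0 < t ∧ t < 1 / ((k : ℝ) + 1) ∧ |s| ≤ 1 / ((k : ℝ) + 1) ∧
      x + t • (v + s • n) ∈ frontier Ω := by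
    intro k
    set ε : ℝ := 1 / ((k : ℝ) + 1) with hε
    have hε0 : 0 < ε := by positivity
    have h1 := hn.enters (v + (-ε) • n) (by
      rw [inner_add_left, inner_smul_left, hv, hn.inner_self]; simpa using hε0)
    have h2 := hn.leaves (v + ε • n) (by
      rw [inner_add_left, inner_smul_left, hv, hn.inner_self]; simpa using hε0)
    obtain ⟨t, ⟨ht1, ht2⟩, ht0, htε⟩ := ((h1.and h2).and (Ioo_mem_nhdsGT hε0)).exists
    have hseg : IsPreconnected ((fun s : ℝ => x + t • (v + s • n)) '' Icc (-ε) ε) :=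
      isPreconnected_Icc.image _ (by fun_prop)
    by_contra hcon
    push Not at hcon
    have hsub := hseg.subset_of_disjoint_frontier hΩ
      ⟨_, mem_image_of_mem _ (left_mem_Icc.2 (by linarith)), ht1⟩ (by
        rintro _ ⟨s, hs, rfl⟩
        exact hcon t s ht0 htε (abs_le.2 ⟨by linarith [hs.1], hs.2⟩))
    exact ht2 (subset_closure (hsub (mem_image_of_mem _ (right_mem_Icc.2 (by linarith)))))
  choose t s ht0 ht hs hmem using key
  have hlim := tendsto_one_div_add_atTop_nhds_zero_nat (𝕜 := ℝ)
  have ht' : Tendsto t atTop (𝓝 0) :=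
    squeeze_zero (fun k => (ht0 k).le) (fun k => (ht k).le) hlim
  have hs' : Tendsto s atTop (𝓝 0) := squeeze_zero_norm hs hlim
  have hvs : Tendsto (fun k => v + s k • n) atTop (𝓝 v) := by
    simpa using tendsto_const_nhds.add (hs'.smul_const n)
  refine mem_tangentConeAt_of_seq atTop (fun k => (t k)⁻¹) (fun k => t k • (v + s k • n))
    (by simpa using ht'.smul hvs) (Eventually.of_forall hmem) ?_
  refine hvs.congr fun k => ?_
  rw [smul_smul, inv_mul_cancel₀ (ht0 k).ne', one_smul]

/-- The tangent cone contains an open half-space, which spans. Derivatives up to the boundary are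
thereby unambiguous. -/
theorem IsOuterUnitNormal.uniqueDiffWithinAt {Ω : Set (Euc N)} {x n : Euc N}
    (hx : x ∈ closure Ω) (hn : IsOuterUnitNormal Ω x n) : UniqueDiffWithinAt ℝ Ω x := by
  have hcone : ∀ v : Euc N, ⟪v, n⟫ < (0 : ℝ) → v ∈ tangentConeAt ℝ Ω x := fun v hv =>
    mem_tangentConeAt_of_add_smul_mem (tendsto_id'.mpr <| nhdsGT_le_nhdsNE 0) (hn.enters v hv)
  refine ⟨?_, hx⟩
  have htop : Submodule.span ℝ (tangentConeAt ℝ Ω x) = ⊤ := by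
    refine Submodule.eq_top_iff'.2 fun w => ?_
    set a : ℝ := ⟪w, n⟫ + 1
    have h1 : w - a • n ∈ Submodule.span ℝ (tangentConeAt ℝ Ω x) := by
      refine Submodule.subset_span (hcone _ ?_)
      rw [inner_sub_left, inner_smul_left, hn.inner_self]
      simp [a]
    have h2 : -n ∈ Submodule.span ℝ (tangentConeAt ℝ Ω x) := by
      refine Submodule.subset_span (hcone _ ?_)
      rw [inner_neg_left, hn.inner_self]; norm_num
    have h3 := Submodule.sub_mem _ h1 (Submodule.smul_mem _ a h2)
    simpa using h3
  rw [htop]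
  exact dense_univ

theorem HasC2Boundary.isOuterUnitNormal {Ω : Set (Euc N)} (hΩ : IsOpen Ω) (h2 : HasC2Boundary Ω)
    {x : Euc N} (hx : x ∈ frontier Ω) : IsOuterUnitNormal Ω x (outerNormal Ω x) := by
  obtain ⟨U, φ, hxU, hφ⟩ := h2 x hx
  have h := hφ.isOuterUnitNormal hΩ hxU hx
  rwa [h.outerNormal_eq]

theorem HasC2Boundary.uniqueDiffOn_closure {Ω : Set (Euc N)} (hΩ : IsOpen Ω)
    (h2 : HasC2Boundary Ω) : UniqueDiffOn ℝ (closure Ω) := by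
  intro x hx
  rw [uniqueDiffWithinAt_closure]
  by_cases hxΩ : x ∈ Ω
  · exact hΩ.uniqueDiffWithinAt hxΩ
  · exact (h2.isOuterUnitNormal hΩ (by rw [hΩ.frontier_eq]; exact ⟨hx, hxΩ⟩)).uniqueDiffWithinAt hx

theorem contDiffAt_gradient {φ : Euc N → ℝ} {x : Euc N} (hφ : ContDiffAt ℝ 2 φ x) :
    ContDiffAt ℝ 1 (gradient φ) x := by
  have h : ContDiffAt ℝ 1 (fderiv ℝ φ) x := hφ.fderiv_right (by norm_num)
  exact (InnerProductSpace.toDual ℝ (Euc N)).symm.toContinuousLinearEquiv.contDiff.contDiffAt.comp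
    x h

theorem inner_fderivWithin_gradientWithin {φ : Euc N → ℝ} {s : Set (Euc N)} {x : Euc N}
    (hs : UniqueDiffWithinAt ℝ s x) (h1 : DifferentiableWithinAt ℝ (gradientWithin φ s) s x)
    (h2 : DifferentiableWithinAt ℝ (fderivWithin ℝ φ s) s x) (v w : Euc N) :
    ⟪fderivWithin ℝ (gradientWithin φ s) s x v, w⟫ =
      fderivWithin ℝ (fderivWithin ℝ φ s) s x v w := by
  have e : (fun y => ⟪gradientWithin φ s y, w⟫) = fun y => fderivWithin ℝ φ s y w :=
    funext fun y => inner_gradientWithin_left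
  have hl := (h1.hasFDerivWithinAt).inner ℝ (hasFDerivWithinAt_const w x s)
  have hr := h2.hasFDerivWithinAt.clm_apply (hasFDerivWithinAt_const w x s)
  rw [e] at hl
  have := congrArg (fun L => L v) (hs.eq hl hr)
  simpa using this

theorem inner_fderiv_gradient {φ : Euc N → ℝ} {x : Euc N} (hφ : ContDiffAt ℝ 2 φ x)
    (v w : Euc N) : ⟪fderiv ℝ (gradient φ) x v, w⟫ = fderiv ℝ (fderiv ℝ φ) x v w := by
  have h1 := (contDiffAt_gradient hφ).differentiableAt (by norm_num)
  have h2 := (hφ.fderiv_right (m := 1) (by norm_num)).differentiableAt (by norm_num)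
  simpa [gradientWithin_univ] using inner_fderivWithin_gradientWithin (φ := φ)
    (uniqueDiffWithinAt_univ (x := x)) (by simpa [gradientWithin_univ] using h1.differentiableWithinAt)
    (by simpa using h2.differentiableWithinAt) v w

/-- Near a boundary point the outer normal extends to a `C¹` field whose derivative is symmetric on
the tangent space and takes values in it. -/
theorem HasC2Boundary.exists_contDiffAt_normal {Ω : Set (Euc N)} (hΩ : IsOpen Ω)
    (h2 : HasC2Boundary Ω) {x : Euc N} (hx : x ∈ frontier Ω) :
    ∃ m : Euc N → Euc N, ContDiffAt ℝ 1 m x ∧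
      (∀ᶠ y in 𝓝[frontier Ω] x, outerNormal Ω y = m y) ∧
      (∀ v w : Euc N, ⟪v, outerNormal Ω x⟫ = (0 : ℝ) → ⟪w, outerNormal Ω x⟫ = (0 : ℝ) →
        ⟪fderiv ℝ m x v, w⟫ = ⟪v, fderiv ℝ m x w⟫) ∧
      ∀ v : Euc N, ⟪fderiv ℝ m x v, outerNormal Ω x⟫ = (0 : ℝ) := by
  obtain ⟨U, φ, hxU, hφ⟩ := h2 x hx
  have hU := hφ.isOpen.mem_nhds hxU
  have hφ2 : ContDiffAt ℝ 2 φ x := hφ.contDiffOn.contDiffAt hU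
  have hg1 : ContDiffAt ℝ 1 (gradient φ) x := contDiffAt_gradient hφ2
  have hg0 := hφ.gradient_ne_zero x hxU
  have hν : outerNormal Ω x = ‖gradient φ x‖⁻¹ • gradient φ x :=
    (hφ.isOuterUnitNormal hΩ hxU hx).outerNormal_eq
  have hnorm : ContDiffAt ℝ 1 (fun y => ‖gradient φ y‖⁻¹) x :=
    (hg1.norm ℝ hg0).inv (norm_ne_zero_iff.2 hg0)
  have hm1 : ContDiffAt ℝ 1 (fun y => ‖gradient φ y‖⁻¹ • gradient φ y) x := hnorm.smul hg1
  have hmd := hm1.differentiableAt (by norm_num)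
  refine ⟨fun y => ‖gradient φ y‖⁻¹ • gradient φ y, hm1, ?_, ?_, ?_⟩
  · filter_upwards [self_mem_nhdsWithin, nhdsWithin_le_nhds hU] with y hy hyU
    exact (hφ.isOuterUnitNormal hΩ hyU hy).outerNormal_eq
  · have hperp : ∀ v : Euc N, ⟪v, outerNormal Ω x⟫ = (0 : ℝ) → ⟪gradient φ x, v⟫ = (0 : ℝ) := by
      intro v hv
      rw [hν, inner_smul_right] at hv
      rw [real_inner_comm]
      exact (mul_eq_zero.1 hv).resolve_left (inv_ne_zero (norm_ne_zero_iff.2 hg0))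
    -- Differentiating the factor `‖∇φ‖⁻¹` only produces a multiple of `∇φ`, which a tangent `w`
    -- does not see; the symmetric Hessian of `φ` remains.
    have hf : ∀ v w : Euc N, ⟪w, outerNormal Ω x⟫ = (0 : ℝ) →
        ⟪fderiv ℝ (fun y => ‖gradient φ y‖⁻¹ • gradient φ y) x v, w⟫ =
          ‖gradient φ x‖⁻¹ * fderiv ℝ (fderiv ℝ φ) x v w := by
      intro v w hw
      rw [fderiv_fun_smul (hnorm.differentiableAt (by norm_num))
        (hg1.differentiableAt (by norm_num))]
      simp [inner_add_left, inner_smul_left, inner_fderiv_gradient hφ2]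
      right
      simpa using hperp w hw
    have hsymm : IsSymmSndFDerivAt ℝ φ x := hφ2.isSymmSndFDerivAt (by simp)
    intro v w hv hw
    rw [hf v w hw, real_inner_comm, hf w v hv, hsymm.eq]
  · intro v
    -- Differentiating `|m|² = 1` shows that the derivative of `m` takes tangent values.
    have hconst : (fun y => ⟪‖gradient φ y‖⁻¹ • gradient φ y, ‖gradient φ y‖⁻¹ • gradient φ y⟫)
        =ᶠ[𝓝 x] fun _ => (1 : ℝ) := by
      filter_upwards [hU] with y hy
      have := norm_ne_zero_iff.2 (hφ.gradient_ne_zero y hy)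
      rw [inner_smul_left, inner_smul_right, real_inner_self_eq_norm_sq]
      simp only [conj_trivial]
      field_simp
    have h0 := hconst.fderiv_eq (𝕜 := ℝ)
    have h1 := congrArg (fun L => L v) h0
    simp only [fderiv_inner_apply ℝ hmd hmd, fderiv_fun_const] at h1
    rw [hν]
    rw [real_inner_comm] at h1
    simp only [Pi.zero_apply, zero_apply] at h1
    linarith

/-- Without this bound the `sInf` defining `kappaMin` could be the default value `0` and would bound
nothing. Locally a principal curvature is at most the operator norm of the derivative of the
extended normal; compactness of the frontier does the rest. -/
theorem HasC2Boundary.bddBelow_principalCurvature {Ω : Set (Euc N)} (hΩ : IsOpen Ω)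
    (hΩb : Bornology.IsBounded Ω) (h2 : HasC2Boundary Ω) :
    BddBelow {κ : ℝ | ∃ x ∈ frontier Ω, IsPrincipalCurvature Ω x κ} := by
  have hcomp : IsCompact (frontier Ω) :=
    (Metric.isCompact_of_isClosed_isBounded isClosed_closure hΩb.closure).of_isClosed_subset
      isClosed_frontier frontier_subset_closure
  have hloc : ∀ x ∈ frontier Ω, ∃ t ∈ 𝓝[frontier Ω] x,
      BddBelow {κ : ℝ | ∃ y ∈ t, y ∈ frontier Ω ∧ IsPrincipalCurvature Ω y κ} := by
    intro x hx
    obtain ⟨m, hm, heq, -, -⟩ := h2.exists_contDiffAt_normal hΩ hx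
    have hcont : ContinuousAt (fun y => ‖fderiv ℝ m y‖) x :=
      (hm.fderiv_right (m := 0) (by norm_num)).continuousAt.norm
    have hbd : ∀ᶠ y in 𝓝 x, ‖fderiv ℝ m y‖ < ‖fderiv ℝ m x‖ + 1 :=
      hcont.eventually (gt_mem_nhds (by linarith))
    have hdiff : ∀ᶠ y in 𝓝 x, DifferentiableAt ℝ m y :=
      (hm.eventually (by simp)).mono fun y hy => hy.differentiableAt (by norm_num)
    have hfr := hbd.and hdiff
    refine ⟨_, (eventually_eventually_nhdsWithin.2 heq).and
      (hfr.filter_mono nhdsWithin_le_nhds), -(‖fderiv ℝ m x‖ + 1), ?_⟩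
    rintro κ ⟨y, ⟨hy1, hy2, hy3⟩, hyf, A, hA, v, hv0, hv, hAv⟩
    have hy1 : ∀ᶠ z in 𝓝[frontier Ω] y, outerNormal Ω z = m z := hy1
    have hB : HasFDerivWithinAt (outerNormal Ω) (fderiv ℝ m y) (frontier Ω) y :=
      hy3.hasFDerivAt.hasFDerivWithinAt.congr_of_eventuallyEq hy1 (hy1.self_of_nhdsWithin hyf)
    have hAB : A v = fderiv ℝ m y v :=
      hA.unique_on hB ((h2.isOuterUnitNormal hΩ hyf).mem_tangentConeAt_frontier hΩ hv)
    have hle : ‖κ‖ * ‖v‖ ≤ ‖fderiv ℝ m y‖ * ‖v‖ := by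
      rw [← norm_smul, ← hAv, hAB]; exact ContinuousLinearMap.le_opNorm _ _
    have := le_of_mul_le_mul_right hle (norm_pos_iff.2 hv0)
    have h4 := neg_abs_le κ
    rw [Real.norm_eq_abs] at this
    have hy2 : ‖fderiv ℝ m y‖ < ‖fderiv ℝ m x‖ + 1 := hy2
    linarith
  refine (hcomp.induction_on
    (p := fun s => BddBelow {κ : ℝ | ∃ y ∈ s, y ∈ frontier Ω ∧ IsPrincipalCurvature Ω y κ})
    ?_ ?_ ?_ hloc).mono ?_
  · simp
  · intro s t hst ht
    refine ht.mono ?_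
    rintro κ ⟨y, hy, h⟩
    exact ⟨y, hst hy, h⟩
  · intro s t hs ht
    refine (hs.union ht).mono ?_
    rintro κ ⟨y, hy | hy, h⟩
    · exact Or.inl ⟨y, hy, h⟩
    · exact Or.inr ⟨y, hy, h⟩
  · rintro κ ⟨y, hy, h⟩
    exact ⟨y, hy, hy, h⟩

/-- The Weingarten map is bounded below by the least principal curvature. -/
theorem HasC2Boundary.exists_hasFDerivWithinAt_outerNormal {Ω : Set (Euc N)} (hΩ : IsOpen Ω)
    (hΩb : Bornology.IsBounded Ω) (h2 : HasC2Boundary Ω) {x : Euc N} (hx : x ∈ frontier Ω) :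
    ∃ A : Euc N →L[ℝ] Euc N, HasFDerivWithinAt (outerNormal Ω) A (frontier Ω) x ∧
      (∀ v, ⟪A v, outerNormal Ω x⟫ = (0 : ℝ)) ∧
      ∀ v, ⟪v, outerNormal Ω x⟫ = (0 : ℝ) → kappaMin Ω * ‖v‖ ^ 2 ≤ ⟪A v, v⟫ := by
  obtain ⟨m, hm, heq, hsymm, htan⟩ := h2.exists_contDiffAt_normal hΩ hx
  have hA : HasFDerivWithinAt (outerNormal Ω) (fderiv ℝ m x) (frontier Ω) x :=
    (hm.differentiableAt (by norm_num)).hasFDerivAt.hasFDerivWithinAt.congr_of_eventuallyEq heq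
      (heq.self_of_nhdsWithin hx)
  refine ⟨fderiv ℝ m x, hA, htan, fun v hv => ?_⟩
  rcases eq_or_ne v 0 with rfl | hv0
  · simp
  set T : Submodule ℝ (Euc N) := (ℝ ∙ outerNormal Ω x)ᗮ
  have hT : ∀ w : Euc N, w ∈ T ↔ ⟪w, outerNormal Ω x⟫ = (0 : ℝ) := fun w => by
    rw [Submodule.mem_orthogonal_singleton_iff_inner_left]
  let B : T →ₗ[ℝ] T := ((fderiv ℝ m x : Euc N →ₗ[ℝ] Euc N).comp T.subtype).codRestrict T
    fun w => (hT _).2 (htan w)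
  have hBs : B.IsSymmetric := fun a b => hsymm a b ((hT _).1 a.2) ((hT _).1 b.2)
  let v' : T := ⟨v, (hT v).2 hv⟩
  have hv' : v' ≠ 0 := fun h => hv0 (congrArg Subtype.val h)
  have : Nontrivial T := ⟨⟨v', 0, hv'⟩⟩
  -- The infimum of the Rayleigh quotient of the symmetric Weingarten map is an eigenvalue, hence a
  -- principal curvature, hence at least `kappaMin`.
  have hev := hBs.hasEigenvalue_iInf_of_finiteDimensional
  have hbdd : BddBelow (range fun a : {a : T // a ≠ 0} => RCLike.re ⟪B a, a⟫ / ‖(a : T)‖ ^ 2) := by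
    refine ⟨-‖fderiv ℝ m x‖, ?_⟩
    rintro _ ⟨a, rfl⟩
    have ha : 0 < ‖(a : T)‖ ^ 2 := by
      have := norm_pos_iff.2 a.2
      positivity
    simp only [RCLike.re_to_real]
    rw [le_div_iff₀ ha]
    have h1 : |⟪B a, (a : T)⟫| ≤ ‖B a‖ * ‖(a : T)‖ := abs_real_inner_le_norm _ _
    have h2 : ‖B a‖ ≤ ‖fderiv ℝ m x‖ * ‖(a : T)‖ := (fderiv ℝ m x).le_opNorm _
    have h3 := neg_abs_le ⟪B a, (a : T)⟫
    nlinarith [norm_nonneg (a : T)]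
  have hle := ciInf_le hbdd ⟨v', hv'⟩
  obtain ⟨e, he⟩ := hev.exists_hasEigenvector
  have hmem : kappaMin Ω ≤ ⨅ a : {a : T // a ≠ 0}, RCLike.re ⟪B a, a⟫ / ‖(a : T)‖ ^ 2 := by
    refine csInf_le (h2.bddBelow_principalCurvature hΩ hΩb) ⟨x, hx, _, hA, e, ?_, (hT _).1 e.2, ?_⟩
    · exact fun h => he.2 (Subtype.ext h)
    · exact congrArg Subtype.val he.apply_eq_smul
  have hvpos : 0 < ‖v‖ ^ 2 := by
    have := norm_pos_iff.2 hv0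
    positivity
  have := hmem.trans hle
  simp only [RCLike.re_to_real] at this
  rw [le_div_iff₀ (by exact hvpos)] at this
  exact this

/-- The interior sphere condition. -/
theorem HasC2Boundary.exists_ball_subset {Ω : Set (Euc N)} (hΩ : IsOpen Ω)
    (h2 : HasC2Boundary Ω) {x : Euc N} (hx : x ∈ frontier Ω) :
    ∃ ρ : ℝ, 0 < ρ ∧ Metric.ball (x - ρ • outerNormal Ω x) ρ ⊆ Ω := by
  obtain ⟨U, φ, hxU, hφ⟩ := h2 x hx
  have hU := hφ.isOpen.mem_nhds hxU
  have hφ2 : ContDiffAt ℝ 2 φ x := hφ.contDiffOn.contDiffAt hU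
  have hg0 := hφ.gradient_ne_zero x hxU
  have hgpos := norm_pos_iff.2 hg0
  have hν : outerNormal Ω x = ‖gradient φ x‖⁻¹ • gradient φ x :=
    (hφ.isOuterUnitNormal hΩ hxU hx).outerNormal_eq
  have hn := h2.isOuterUnitNormal hΩ hx
  have hφx : φ x ≤ 0 := by
    by_contra! hpos
    have hev : ∀ᶠ y in 𝓝 x, 0 < φ y := hφ2.continuousAt.eventually (lt_mem_nhds hpos)
    obtain ⟨y, hyΩ, hy, hyU⟩ :=
      ((mem_closure_iff_frequently.1 hx.1).and_eventually (hev.and hU)).exists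
    exact absurd ((hφ.mem_iff y hyU).1 hyΩ) (not_lt.2 hy.le)
  obtain ⟨K, t, ht, hK⟩ :=
    (hφ2.fderiv_right (m := 1) (by norm_num)).exists_lipschitzOnWith
  obtain ⟨δ, hδ, hδs⟩ := Metric.mem_nhds_iff.1 (inter_mem ht hU)
  have htaylor : ∀ h : Euc N, ‖h‖ < δ → φ (x + h) ≤ ⟪gradient φ x, h⟫ + K * ‖h‖ ^ 2 := by
    intro h hh
    have hsub : segment ℝ x (x + h) ⊆ Metric.closedBall x ‖h‖ :=
      (convex_closedBall x ‖h‖).segment_subset (by simp) (by simp)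
    have hb := (convex_segment (𝕜 := ℝ) x (x + h)).norm_image_sub_le_of_norm_hasFDerivWithin_le'
      (f := φ) (f' := fun y => fderiv ℝ φ y) (φ := fderiv ℝ φ x) (C := K * ‖h‖)
      (fun y hy => by
        have hyb : y ∈ Metric.ball x δ :=
          (Metric.mem_closedBall.1 (hsub hy)).trans_lt hh
        exact (((hφ.contDiffOn.contDiffAt
          (hφ.isOpen.mem_nhds (hδs hyb).2)).differentiableAt
            (by norm_num)).hasFDerivAt).hasFDerivWithinAt)
      (fun y hy => by
        have hyb : y ∈ Metric.ball x δ :=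
          (Metric.mem_closedBall.1 (hsub hy)).trans_lt hh
        refine (hK.norm_sub_le (hδs hyb).1 (mem_of_mem_nhds ht)).trans ?_
        gcongr
        exact mem_closedBall_iff_norm.1 (hsub hy))
      (left_mem_segment ℝ _ _) (right_mem_segment ℝ _ _)
    rw [add_sub_cancel_left, Real.norm_eq_abs, ← inner_gradient_left] at hb
    have := (abs_le.1 hb).2
    nlinarith
  set g := ‖gradient φ x‖
  -- A point `x + h` of the ball satisfies `|h|² + 2ρ⟪h, ν⟫ < 0`, that is `⟪∇φ, h⟫ < -(g / 2ρ)|h|²`.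
  -- The second bound on `ρ` makes `g / 2ρ ≥ K + 1`, which beats the Taylor error `K|h|²`; the first
  -- keeps `|h| < 2ρ ≤ δ`.
  refine ⟨min (δ / 2) (g / (2 * (K + 1))), by positivity, ?_⟩
  set ρ := min (δ / 2) (g / (2 * (K + 1)))
  have hρ : 0 < ρ := by positivity
  have hρ1 : ρ ≤ δ / 2 := min_le_left _ _
  have hρ2 : ρ * (2 * (K + 1)) ≤ g := (le_div_iff₀ (by positivity)).1 (min_le_right _ _)
  intro z hz
  obtain ⟨h, rfl⟩ : ∃ h, z = x + h := ⟨z - x, by simp⟩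
  rw [mem_ball_iff_norm] at hz
  have hz' : ‖h + ρ • outerNormal Ω x‖ < ρ := by
    rwa [show x + h - (x - ρ • outerNormal Ω x) = h + ρ • outerNormal Ω x by module] at hz
  have hnorm1 : ‖ρ • outerNormal Ω x‖ = ρ := by
    rw [norm_smul, hn.norm_eq_one, Real.norm_eq_abs, abs_of_pos hρ, mul_one]
  have hhδ : ‖h‖ < δ := by
    have := norm_sub_le (h + ρ • outerNormal Ω x) (ρ • outerNormal Ω x)
    rw [add_sub_cancel_right] at this
    linarith
  have hhU : x + h ∈ U := (hδs (by simpa using hhδ)).2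
  refine (hφ.mem_iff _ hhU).2 ((htaylor h hhδ).trans_lt ?_)
  have hexp := norm_add_sq_real h (ρ • outerNormal Ω x)
  rw [hnorm1, inner_smul_right, hν, inner_smul_right, real_inner_comm] at hexp
  have hsq : ‖h + ρ • outerNormal Ω x‖ ^ 2 < ρ ^ 2 := by
    gcongr
  rw [hν] at hsq
  have hk : ‖h‖ ^ 2 + 2 * (ρ * (g⁻¹ * ⟪gradient φ x, h⟫)) < 0 := by linarith
  have hk2 : g * ‖h‖ ^ 2 + 2 * ρ * ⟪gradient φ x, h⟫ < 0 := by
    have := mul_neg_of_pos_of_neg hgpos hk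
    have e : g * (‖h‖ ^ 2 + 2 * (ρ * (g⁻¹ * ⟪gradient φ x, h⟫))) =
      g * ‖h‖ ^ 2 + 2 * ρ * ⟪gradient φ x, h⟫ := by
      field_simp
    linarith
  have hle : ρ * (2 * (K + 1)) * ‖h‖ ^ 2 ≤ g * ‖h‖ ^ 2 := by gcongr
  have : 2 * ρ * (⟪gradient φ x, h⟫ + K * ‖h‖ ^ 2) < 0 := by
    nlinarith [mul_nonneg hρ.le (sq_nonneg ‖h‖)]
  exact neg_of_mul_neg_right this (by positivity)

end RobinTorsion

/-! ### Second derivative test and difference quotients -/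

/-- A positive second derivative would make the point a local minimum too, so the function would be
locally constant and its second derivative zero. -/
theorem nonpos_of_isLocalMax_of_hasDerivAt {g g' : ℝ → ℝ} {g'' a : ℝ} (hmax : IsLocalMax g a)
    (hg : ∀ᶠ s in 𝓝 a, HasDerivAt g (g' s) s) (hg' : HasDerivAt g' g'' a) : g'' ≤ 0 := by
  by_contra! hpos
  have hd : deriv g =ᶠ[𝓝 a] g' := hg.mono fun s hs => hs.deriv
  have hdd : deriv (deriv g) a = g'' := by rw [hd.deriv_eq, hg'.deriv]
  have hmin := isLocalMin_of_deriv_deriv_pos (by rwa [hdd]) hmax.deriv_eq_zero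
    hg.self_of_nhds.continuousAt
  have hconst : g =ᶠ[𝓝 a] fun _ => g a := by
    filter_upwards [hmax, hmin] with s h1 h2 using le_antisymm h1 h2
  have h0 : deriv g =ᶠ[𝓝 a] fun _ => 0 := by
    filter_upwards [hconst.eventuallyEq_nhds] with s hs
    rw [hs.deriv_eq]; simp
  rw [h0.deriv_eq] at hdd
  simp at hdd
  exact hpos.ne hdd

/-- Strict differentiability lets the base point move with `n`, as is needed when it is a maximum
point of the `n`-th approximation. -/
theorem HasStrictFDerivAt.tendsto_difference_quotient {E F : Type*} [NormedAddCommGroup E]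
    [NormedSpace ℝ E] [NormedAddCommGroup F] [NormedSpace ℝ F] {f : E → F} {f' : E →L[ℝ] F}
    {x : E} (hf : HasStrictFDerivAt f f' x) {t : ℕ → ℝ} (ht0 : ∀ n, 0 < t n)
    (ht : Tendsto t atTop (𝓝 0)) {q : ℕ → E} (hq : Tendsto q atTop (𝓝 x)) (v : E) :
    Tendsto (fun n => (t n)⁻¹ • (f (q n + t n • v) - f (q n))) atTop (𝓝 (f' v)) := by
  have h1 : Tendsto (fun n => (q n + t n • v, q n)) atTop (𝓝 (x, x)) := by
    refine Tendsto.prodMk_nhds ?_ hq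
    simpa using hq.add (ht.smul_const v)
  have h2 := hf.isLittleO.comp_tendsto h1
  have h3 : (fun n => t n • v) =O[atTop] t :=
    Asymptotics.IsBigO.of_bound ‖v‖ (Eventually.of_forall fun n => by
      rw [norm_smul, mul_comm])
  have h4 : (fun n => f (q n + t n • v) - f (q n) - f' (t n • v)) =o[atTop] t := by
    refine Asymptotics.IsLittleO.trans_isBigO ?_ h3
    simpa [Function.comp_def] using h2
  have h5 : Tendsto (fun n => (t n)⁻¹ • (f (q n + t n • v) - f (q n) - f' (t n • v))) atTop
      (𝓝 0) := h4.tendsto_inv_smul_nhds_zero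
  have h6 := h5.add_const (f' v)
  rw [zero_add] at h6
  refine h6.congr fun n => ?_
  rw [map_smul, smul_sub, smul_smul, inv_mul_cancel₀ (ht0 n).ne', one_smul, sub_add_cancel]

theorem ContDiffAt.hasDerivAt_comp_add_smul {E : Type*} [NormedAddCommGroup E]
    [NormedSpace ℝ E] {f : E → ℝ} {x : E}
    (hf : ContDiffAt ℝ 2 f x) (v : E) :
    (∀ᶠ s : ℝ in 𝓝 0, HasDerivAt (fun s : ℝ => f (x + s • v)) (fderiv ℝ f (x + s • v) v) s) ∧
      HasDerivAt (fun s : ℝ => fderiv ℝ f (x + s • v) v) (fderiv ℝ (fderiv ℝ f) x v v) 0 := by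
  have hline : ∀ s : ℝ, HasDerivAt (fun s : ℝ => x + s • v) v s := fun s => by
    simpa using ((hasDerivAt_id s).smul_const v).const_add x
  have hcont : Tendsto (fun s : ℝ => x + s • v) (𝓝 0) (𝓝 x) := by
    simpa using (hline 0).continuousAt.tendsto
  have hev : ∀ᶠ y in 𝓝 x, DifferentiableAt ℝ f y :=
    (hf.eventually (by simp)).mono fun y hy => hy.differentiableAt (by norm_num)
  constructor
  · filter_upwards [hcont.eventually hev] with s hs
    exact HasFDerivAt.comp_hasDerivAt (f := fun s : ℝ => x + s • v) s hs.hasFDerivAt (hline s)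
  · have h2 : HasFDerivAt (fderiv ℝ f) (fderiv ℝ (fderiv ℝ f) x) x :=
      ((hf.fderiv_right (m := 1) (by norm_num)).differentiableAt (by norm_num)).hasFDerivAt
    have h3 : HasFDerivAt (fun y => fderiv ℝ f y v) ((fderiv ℝ (fderiv ℝ f) x).flip v) x := by
      simpa using h2.clm_apply (hasFDerivAt_const v x)
    have h4 : HasFDerivAt (fun y => fderiv ℝ f y v) ((fderiv ℝ (fderiv ℝ f) x).flip v)
        (x + (0 : ℝ) • v) := by
      rwa [zero_smul, add_zero]
    exact HasFDerivAt.comp_hasDerivAt (f := fun s : ℝ => x + s • v) 0 h4 (hline 0)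

/-! ### Calculus of the Laplacian -/

section Laplacian

open Laplacian

variable {ι E : Type*} [Fintype ι] [NormedAddCommGroup E] [InnerProductSpace ℝ E]
  [FiniteDimensional ℝ E] (b : OrthonormalBasis ι ℝ E)

theorem laplacian_eq_sum_fderiv_fderiv (f : E → ℝ) (x : E) :
    Δ f x = ∑ j, fderiv ℝ (fderiv ℝ f) x (b j) (b j) := by
  rw [InnerProductSpace.laplacian_eq_iteratedFDeriv_orthonormalBasis f b]
  simp [iteratedFDeriv_two_apply]

theorem ContDiffAt.laplacian_fun_add {f g : E → ℝ} {x : E} (hf : ContDiffAt ℝ 2 f x)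
    (hg : ContDiffAt ℝ 2 g x) : Δ (fun y => f y + g y) x = Δ f x + Δ g x :=
  hf.laplacian_add hg

theorem ContDiffAt.laplacian_fun_sub {f g : E → ℝ} {x : E} (hf : ContDiffAt ℝ 2 f x)
    (hg : ContDiffAt ℝ 2 g x) : Δ (fun y => f y - g y) x = Δ f x - Δ g x :=
  hf.laplacian_sub hg

theorem ContDiffAt.laplacian_const_mul (c : ℝ) {f : E → ℝ} {x : E} (hf : ContDiffAt ℝ 2 f x) :
    Δ (fun y => c * f y) x = c * Δ f x := by
  have h := InnerProductSpace.laplacian_smul (𝕜 := ℝ) c hf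
  rw [smul_eq_mul] at h
  rw [← h]
  rfl

theorem IsLocalMax.laplacian_nonpos {f : E → ℝ} {x : E} (hmax : IsLocalMax f x)
    (hf : ContDiffAt ℝ 2 f x) : Δ f x ≤ 0 := by
  rw [laplacian_eq_sum_fderiv_fderiv (stdOrthonormalBasis ℝ E)]
  refine Finset.sum_nonpos fun j _ => ?_
  set v := stdOrthonormalBasis ℝ E j
  obtain ⟨h1, h2⟩ := hf.hasDerivAt_comp_add_smul v
  refine nonpos_of_isLocalMax_of_hasDerivAt ?_ h1 h2
  have hcont : ContinuousAt (fun s : ℝ => x + s • v) 0 := by fun_prop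
  have hmax' : IsLocalMax f (x + (0 : ℝ) • v) := by simpa using hmax
  exact IsMaxFilter.comp_tendsto (g := fun s : ℝ => x + s • v) hmax' hcont

theorem ContDiffAt.laplacian_sq {f : E → ℝ} {x : E} (hf : ContDiffAt ℝ 2 f x) :
    Δ (fun y => f y ^ 2) x = 2 * f x * Δ f x + 2 * ∑ j, fderiv ℝ f x (b j) ^ 2 := by
  rw [laplacian_eq_sum_fderiv_fderiv b, laplacian_eq_sum_fderiv_fderiv b, Finset.mul_sum,
    Finset.mul_sum, ← Finset.sum_add_distrib]
  refine Finset.sum_congr rfl fun j _ => ?_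
  have h1 : fderiv ℝ (fun y => f y ^ 2) =ᶠ[𝓝 x] fun y => (2 * f y) • fderiv ℝ f y := by
    filter_upwards [hf.eventually (by simp)] with y hy
    rw [fderiv_fun_pow _ (hy.differentiableAt (by norm_num))]
    simp
  have hd := (hf.differentiableAt (by norm_num)).hasFDerivAt
  have hdd := ((hf.fderiv_right (m := 1) (by norm_num)).differentiableAt
    (by norm_num)).hasFDerivAt
  rw [h1.fderiv_eq, ((hd.const_mul 2).fun_smul hdd).fderiv]
  simp
  ring

theorem ContDiffAt.laplacian_sum {κ : Type*} (s : Finset κ) {f : κ → E → ℝ} {x : E}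
    (hf : ∀ i ∈ s, ContDiffAt ℝ 2 (f i) x) :
    Δ (fun y => ∑ i ∈ s, f i y) x = ∑ i ∈ s, Δ (f i) x := by
  classical
  induction s using Finset.induction_on with
  | empty => exact congrFun (InnerProductSpace.laplacian_const (E := E) (c := (0 : ℝ))) x
  | insert i s his ih =>
    have h1 := hf i (Finset.mem_insert_self _ _)
    have h2 : ∀ k ∈ s, ContDiffAt ℝ 2 (f k) x := fun k hk => hf k (Finset.mem_insert_of_mem hk)
    have h3 : ContDiffAt ℝ 2 (fun y => ∑ k ∈ s, f k y) x := ContDiffAt.sum h2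
    simp only [Finset.sum_insert his]
    rw [← ih h2, ← h1.laplacian_add h3]
    rfl

theorem laplacian_comp_add_right (f : E → ℝ) (x h : E) :
    Δ (fun y => f (y + h)) x = Δ f (x + h) := by
  rw [laplacian_eq_sum_fderiv_fderiv (stdOrthonormalBasis ℝ E),
    laplacian_eq_sum_fderiv_fderiv (stdOrthonormalBasis ℝ E)]
  have h1 : fderiv ℝ (fun y => f (y + h)) = fun y => fderiv ℝ f (y + h) :=
    funext fun y => fderiv_comp_add_right h
  rw [h1, fderiv_comp_add_right]

theorem laplacian_norm_sub_sq (p x : E) :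
    Δ (fun y => ‖y - p‖ ^ 2) x = 2 * Module.finrank ℝ E := by
  have h1 : fderiv ℝ (fun y => ‖y - p‖ ^ 2) = fun y => (2 : ℝ) • innerSL ℝ (y - p) := by
    funext y
    have : HasFDerivAt (fun y => ‖y - p‖ ^ 2) _ y := ((hasFDerivAt_id y).sub_const p).norm_sq
    rw [this.fderiv]
    ext v
    simp
  rw [laplacian_eq_sum_fderiv_fderiv (stdOrthonormalBasis ℝ E), h1]
  have h2 : HasFDerivAt (fun y => (2 : ℝ) • innerSL ℝ (y - p)) ((2 : ℝ) • innerSL ℝ (E := E)) x := by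
    have := ((2 : ℝ) • innerSL ℝ (E := E)).hasFDerivAt.comp x (hasFDerivAt_sub_const p)
    rwa [ContinuousLinearMap.comp_id] at this
  rw [h2.fderiv]
  have h3 : ∀ j, ((2 : ℝ) • innerSL ℝ (E := E)) (stdOrthonormalBasis ℝ E j)
      (stdOrthonormalBasis ℝ E j) = 2 := fun j => by
    change (2 : ℝ) * ⟪stdOrthonormalBasis ℝ E j, stdOrthonormalBasis ℝ E j⟫ = 2
    rw [real_inner_self_eq_norm_sq]
    simp
  rw [Finset.sum_congr rfl fun j _ => h3 j]
  simp [mul_comm]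

end Laplacian

/-! ### The weak Bochner inequality for `C²` functions -/

section Viscosity

open Laplacian

variable {ι E : Type*} [Fintype ι] [NormedAddCommGroup E] [InnerProductSpace ℝ E]
  [FiniteDimensional ℝ E] (b : OrthonormalBasis ι ℝ E)

/-- Difference quotients `d` of `u` are `C²` and harmonic, because `Δu` is constant. Hence `Δ(d²) =
2|∇d|²`, a discrete Bochner formula that needs no third derivatives. -/
theorem laplacian_sum_difference_quotient_sq {u w : E → ℝ} {c t : ℝ} {q : E}
    (hu : ContDiffAt ℝ 2 u q) (hut : ∀ i, ContDiffAt ℝ 2 u (q + t • b i)) (hΔ : Δ u q = c)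
    (hΔt : ∀ i, Δ u (q + t • b i) = c) (hw : ContDiffAt ℝ 2 w q) :
    ContDiffAt ℝ 2 (fun x => ∑ i, (t⁻¹ * (u (x + t • b i) - u x)) ^ 2 + (w x - 2 * u x)) q ∧
    Δ (fun x => ∑ i, (t⁻¹ * (u (x + t • b i) - u x)) ^ 2 + (w x - 2 * u x)) q =
      2 * ∑ i, ∑ j, (t⁻¹ * (fderiv ℝ u (q + t • b i) (b j) - fderiv ℝ u q (b j))) ^ 2 +
        (Δ w q - 2 * c) := by
  have htr : ∀ i, ContDiffAt ℝ 2 (fun x => u (x + t • b i)) q := fun i =>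
    ContDiffAt.comp (g := u) q (hut i) (contDiffAt_id.add contDiffAt_const)
  have hdiff : ∀ i, ContDiffAt ℝ 2 (fun x => u (x + t • b i) - u x) q := fun i => (htr i).sub hu
  have hd : ∀ i, ContDiffAt ℝ 2 (fun x => t⁻¹ * (u (x + t • b i) - u x)) q := fun i =>
    contDiffAt_const.mul (hdiff i)
  have hsum : ContDiffAt ℝ 2 (fun x => ∑ i, (t⁻¹ * (u (x + t • b i) - u x)) ^ 2) q :=
    ContDiffAt.sum fun i _ => (hd i).pow 2
  have h2u : ContDiffAt ℝ 2 (fun x => 2 * u x) q := contDiffAt_const.mul hu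
  have hΔd : ∀ i, Δ (fun x => t⁻¹ * (u (x + t • b i) - u x)) q = 0 := by
    intro i
    have h2 : Δ (fun x => u (x + t • b i) - u x) q = 0 := by
      rw [(htr i).laplacian_fun_sub hu, laplacian_comp_add_right, hΔt, hΔ, sub_self]
    rw [(hdiff i).laplacian_const_mul, h2, mul_zero]
  have hfd : ∀ i j, fderiv ℝ (fun x => t⁻¹ * (u (x + t • b i) - u x)) q (b j) =
      t⁻¹ * (fderiv ℝ u (q + t • b i) (b j) - fderiv ℝ u q (b j)) := by
    intro i j
    have d1 := (htr i).differentiableAt (by norm_num)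
    have d2 := hu.differentiableAt (by norm_num)
    have h1 : HasFDerivAt (fun x => u (x + t • b i) - u x)
        (fderiv ℝ u (q + t • b i) - fderiv ℝ u q) q := by
      rw [← fderiv_comp_add_right]
      exact d1.hasFDerivAt.sub d2.hasFDerivAt
    rw [(h1.const_mul t⁻¹).fderiv]
    simp
  refine ⟨hsum.add (hw.sub h2u), ?_⟩
  rw [hsum.laplacian_fun_add (hw.sub h2u), hw.laplacian_fun_sub h2u, hu.laplacian_const_mul, hΔ,
    ContDiffAt.laplacian_sum _ fun i _ => (hd i).pow 2, Finset.mul_sum]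
  congr 1
  refine Finset.sum_congr rfl fun i _ => ?_
  rw [ContDiffAt.laplacian_sq b (hd i), hΔd]
  simp [hfd]

/-- Where `|∇u|² - 2u + w` has a strict local maximum, its formal Laplacian is nonpositive, although
`u` is only assumed to be of class `C²`. -/
theorem formal_laplacian_nonpos_of_strict_localMax {Ω : Set E} (hΩ : IsOpen Ω) {u w : E → ℝ} {c : ℝ}
    (hu : ContDiffOn ℝ 2 u Ω) (hΔ : ∀ x ∈ Ω, Δ u x = c) {p : E} (hp : p ∈ Ω)
    (hw : ContDiffAt ℝ 2 w p)
    (hmax : ∀ᶠ q in 𝓝 p, q ≠ p → ∑ i, fderiv ℝ u q (b i) ^ 2 + (w q - 2 * u q) <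
      ∑ i, fderiv ℝ u p (b i) ^ 2 + (w p - 2 * u p)) :
    2 * ∑ i, ∑ j, fderiv ℝ (fderiv ℝ u) p (b i) (b j) ^ 2 + (Δ w p - 2 * c) ≤ 0 := by
  have huA : ∀ x ∈ Ω, ContDiffAt ℝ 2 u x := fun x hx => hu.contDiffAt (hΩ.mem_nhds hx)
  obtain ⟨δ, hδ, hball⟩ := Metric.eventually_nhds_iff_ball.1
    (hmax.and ((hΩ.eventually_mem hp).and (hw.eventually (by simp))))
  -- The translates by `t n ≤ r` of the closed ball of radius `r` stay within distance `2r < δ` of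
  -- `p`.
  set r := δ / 3 with hr
  have hr0 : 0 < r := by positivity
  set t : ℕ → ℝ := fun n => r * (1 / ((n : ℝ) + 1)) with ht
  have ht0 : ∀ n, 0 < t n := fun n => by positivity
  have ht1 : ∀ n, t n ≤ r := fun n => by
    refine mul_le_of_le_one_right hr0.le ?_
    rw [div_le_one (by positivity)]
    linarith [(Nat.cast_nonneg n : (0 : ℝ) ≤ n)]
  have htlim : Tendsto t atTop (𝓝 0) := by
    simpa [ht] using (tendsto_one_div_add_atTop_nhds_zero_nat (𝕜 := ℝ)).const_mul r
  have hsub : ∀ q ∈ Metric.closedBall p r, q ∈ Metric.ball p δ := fun q hq =>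
    Metric.closedBall_subset_ball (by linarith) hq
  have hsubt : ∀ n i, ∀ q ∈ Metric.closedBall p r, q + t n • b i ∈ Ω := by
    intro n i q hq
    refine (hball _ ?_).2.1
    rw [mem_ball_iff_norm]
    have h1 : ‖q - p‖ ≤ r := mem_closedBall_iff_norm.1 hq
    have h2 : ‖t n • b i‖ ≤ r := by
      rw [norm_smul, b.norm_eq_one, mul_one, Real.norm_eq_abs, abs_of_pos (ht0 n)]
      exact ht1 n
    calc ‖q + t n • b i - p‖ = ‖(q - p) + t n • b i‖ := by congr 1; abel
      _ ≤ r + r := (norm_add_le _ _).trans (add_le_add h1 h2)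
      _ < δ := by linarith
  set F : ℕ → E → ℝ := fun n x =>
    ∑ i, ((t n)⁻¹ * (u (x + t n • b i) - u x)) ^ 2 + (w x - 2 * u x) with hF
  set F₀ : E → ℝ := fun x => ∑ i, fderiv ℝ u x (b i) ^ 2 + (w x - 2 * u x) with hF₀
  have hstep : ∀ n, ∀ q ∈ Metric.closedBall p r, ContDiffAt ℝ 2 (F n) q ∧ Δ (F n) q =
      2 * ∑ i, ∑ j, ((t n)⁻¹ * (fderiv ℝ u (q + t n • b i) (b j) - fderiv ℝ u q (b j))) ^ 2 +
        (Δ w q - 2 * c) := fun n q hq =>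
    laplacian_sum_difference_quotient_sq b (huA q (hball q (hsub q hq)).2.1)
      (fun i => huA _ (hsubt n i q hq)) (hΔ q (hball q (hsub q hq)).2.1)
      (fun i => hΔ _ (hsubt n i q hq)) (hball q (hsub q hq)).2.2
  have hFlim : ∀ {φ : ℕ → ℕ}, StrictMono φ → ∀ {q : ℕ → E} {q₀ : E}, q₀ ∈ Metric.closedBall p r →
      Tendsto q atTop (𝓝 q₀) → Tendsto (fun n => F (φ n) (q n)) atTop (𝓝 (F₀ q₀)) := by
    intro φ hφ q q₀ hq₀ hq
    have hu₀ := huA q₀ (hball q₀ (hsub q₀ hq₀)).2.1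
    have hw₀ := (hball q₀ (hsub q₀ hq₀)).2.2
    have hs : HasStrictFDerivAt u (fderiv ℝ u q₀) q₀ := hu₀.hasStrictFDerivAt (by norm_num)
    refine Tendsto.add (tendsto_finsetSum _ fun i _ => ?_) ?_
    · exact (hs.tendsto_difference_quotient (t := t ∘ φ) (fun n => ht0 _)
        (htlim.comp hφ.tendsto_atTop) hq (b i)).pow 2
    · exact ((hw₀.continuousAt.tendsto.comp hq).sub
        ((hu₀.continuousAt.tendsto.comp hq).const_mul 2))
  -- The maximum points of the approximations `F n` accumulate only at `p`, since the maximum of the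
  -- limit `F₀` is strict. They are then interior, so `Δ (F n) ≤ 0` there, and this passes to the
  -- limit because `∇²u` is continuous.
  have hex : ∀ n, ∃ q ∈ Metric.closedBall p r, IsMaxOn (F n) (Metric.closedBall p r) q := fun n =>
    (isCompact_closedBall p r).exists_isMaxOn ⟨p, by simp [hr0.le]⟩
      fun q hq => (hstep n q hq).1.continuousAt.continuousWithinAt
  choose q hqmem hqmax using hex
  obtain ⟨q₀, hq₀, φ, hφ, hlim⟩ := (isCompact_closedBall p r).tendsto_subseq hqmem
  have hpmem : p ∈ Metric.closedBall p r := by simp [hr0.le]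
  have hge : F₀ p ≤ F₀ q₀ :=
    le_of_tendsto_of_tendsto' (hFlim hφ hpmem tendsto_const_nhds) (hFlim hφ hq₀ hlim)
      fun n => hqmax (φ n) hpmem
  have hq₀p : q₀ = p := by
    by_contra hne
    exact absurd hge (not_le.2 ((hball q₀ (hsub q₀ hq₀)).1 hne))
  subst hq₀p
  have hs : HasStrictFDerivAt (fderiv ℝ u) (fderiv ℝ (fderiv ℝ u) q₀) q₀ :=
    ((huA q₀ hp).fderiv_right (m := 1) (by norm_num)).hasStrictFDerivAt (by norm_num)
  have hΔw : ContinuousAt (Δ w) q₀ := by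
    have : Δ w = fun x => ∑ j, fderiv ℝ (fderiv ℝ w) x (b j) (b j) :=
      funext fun x => laplacian_eq_sum_fderiv_fderiv b w x
    rw [this]
    have h2 : ContinuousAt (fderiv ℝ (fderiv ℝ w)) q₀ :=
      ((hw.fderiv_right (m := 1) (by norm_num)).fderiv_right (m := 0) (by norm_num)).continuousAt
    exact tendsto_finsetSum _ fun j _ =>
      (h2.clm_apply continuousAt_const).clm_apply continuousAt_const
  have hlimΔ : Tendsto (fun n => Δ (F (φ n)) (q (φ n))) atTop
      (𝓝 (2 * ∑ i, ∑ j, fderiv ℝ (fderiv ℝ u) q₀ (b i) (b j) ^ 2 + (Δ w q₀ - 2 * c))) := by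
    have h : Tendsto (fun n => 2 * ∑ i, ∑ j, ((t (φ n))⁻¹ *
        (fderiv ℝ u (q (φ n) + t (φ n) • b i) (b j) - fderiv ℝ u (q (φ n)) (b j))) ^ 2 +
        (Δ w (q (φ n)) - 2 * c)) atTop
      (𝓝 (2 * ∑ i, ∑ j, fderiv ℝ (fderiv ℝ u) q₀ (b i) (b j) ^ 2 + (Δ w q₀ - 2 * c))) := by
      refine Tendsto.add (Tendsto.const_mul _ (tendsto_finsetSum _ fun i _ =>
        tendsto_finsetSum _ fun j _ => ?_)) ((hΔw.tendsto.comp hlim).sub_const _)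
      have h1 := hs.tendsto_difference_quotient (t := t ∘ φ) (fun n => ht0 _)
        (htlim.comp hφ.tendsto_atTop) hlim (b i)
      have h2 : Continuous fun L : E →L[ℝ] ℝ => L (b j) ^ 2 := by fun_prop
      simpa [Function.comp_def] using (h2.tendsto _).comp h1
    exact h.congr fun n => ((hstep _ _ (hqmem _)).2).symm
  refine le_of_tendsto hlimΔ ?_
  filter_upwards [hlim.eventually (Metric.ball_mem_nhds q₀ hr0)] with n hn
  refine IsLocalMax.laplacian_nonpos ?_ (hstep _ _ (hqmem _)).1
  exact (hqmax (φ n)).isLocalMax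
    (mem_of_superset (Metric.isOpen_ball.mem_nhds hn) Metric.ball_subset_closedBall)

/-- Subtracting `η|x - p|²` makes the maximum strict and costs only a multiple of `η`, which then
tends to `0`. -/
theorem formal_laplacian_nonpos_of_localMax {Ω : Set E} (hΩ : IsOpen Ω) {u w : E → ℝ} {c : ℝ}
    (hu : ContDiffOn ℝ 2 u Ω) (hΔ : ∀ x ∈ Ω, Δ u x = c) {p : E} (hp : p ∈ Ω)
    (hw : ContDiffAt ℝ 2 w p)
    (hmax : IsLocalMax (fun x => ∑ i, fderiv ℝ u x (b i) ^ 2 - 2 * u x + w x) p) :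
    2 * ∑ i, ∑ j, fderiv ℝ (fderiv ℝ u) p (b i) (b j) ^ 2 + (Δ w p - 2 * c) ≤ 0 := by
  have hsq : ContDiff ℝ 2 fun x : E => ‖x - p‖ ^ 2 := (contDiff_id.sub contDiff_const).norm_sq ℝ
  have key : ∀ η : ℝ, 0 < η → 2 * ∑ i, ∑ j, fderiv ℝ (fderiv ℝ u) p (b i) (b j) ^ 2 +
      (Δ w p - 2 * c) ≤ η * (2 * Module.finrank ℝ E) := by
    intro η hη
    have hηsq : ContDiffAt ℝ 2 (fun x : E => η * ‖x - p‖ ^ 2) p :=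
      contDiffAt_const.mul hsq.contDiffAt
    have h := formal_laplacian_nonpos_of_strict_localMax b hΩ (w := fun x => w x - η * ‖x - p‖ ^ 2)
      hu hΔ hp (hw.sub hηsq) (by
        filter_upwards [hmax] with q hq hne
        have : 0 < η * ‖q - p‖ ^ 2 := by
          have := norm_pos_iff.2 (sub_ne_zero.2 hne)
          positivity
        simp only [sub_self, norm_zero]
        linarith)
    rw [hw.laplacian_fun_sub hηsq, hsq.contDiffAt.laplacian_const_mul, laplacian_norm_sub_sq] at h
    linarith
  have hlim : Tendsto (fun η : ℝ => η * (2 * Module.finrank ℝ E)) (𝓝[>] 0) (𝓝 0) := by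
    have : Continuous fun η : ℝ => η * (2 * Module.finrank ℝ E : ℝ) := by fun_prop
    simpa using (this.tendsto 0).mono_left nhdsWithin_le_nhds
  exact ge_of_tendsto hlim (eventually_mem_nhdsWithin.mono key)

end Viscosity

/-! ### Hopf lemma and strong maximum principle in the viscosity sense -/

section Hopf

open Laplacian

variable {E : Type*} [NormedAddCommGroup E] [InnerProductSpace ℝ E] [FiniteDimensional ℝ E]

/-- `P` is subharmonic on `Ω` in the viscosity sense, for `C²` test functions. -/
def ViscositySubharmonicOn (P : E → ℝ) (Ω : Set E) : Prop :=
  ∀ p ∈ Ω, ∀ w : E → ℝ, ContDiffAt ℝ 2 w p → IsLocalMax (fun x => P x + w x) p → Δ w p ≤ 0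

theorem hasFDerivAt_exp_neg_mul_norm_sub_sq {E : Type*} [NormedAddCommGroup E]
    [InnerProductSpace ℝ E] (α : ℝ) (y x : E) :
    HasFDerivAt (fun z => Real.exp (-α * ‖z - y‖ ^ 2))
      ((-(2 * α) * Real.exp (-α * ‖x - y‖ ^ 2)) • innerSL ℝ (x - y)) x := by
  have h1 : HasFDerivAt (fun z => ‖z - y‖ ^ 2) _ x := (hasFDerivAt_sub_const y).norm_sq
  have h2 := (h1.const_mul (-α)).exp
  refine h2.congr_fderiv ?_
  ext v
  simp
  ring

theorem laplacian_exp_neg_mul_norm_sub_sq (α : ℝ) (y x : E) :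
    Δ (fun z => Real.exp (-α * ‖z - y‖ ^ 2)) x =
      Real.exp (-α * ‖x - y‖ ^ 2) * (4 * α ^ 2 * ‖x - y‖ ^ 2 - 2 * α * Module.finrank ℝ E) := by
  have h1 : fderiv ℝ (fun z => Real.exp (-α * ‖z - y‖ ^ 2)) =
      fun z => (-(2 * α) * Real.exp (-α * ‖z - y‖ ^ 2)) • innerSL ℝ (z - y) :=
    funext fun z => (hasFDerivAt_exp_neg_mul_norm_sub_sq α y z).fderiv
  have h2 : HasFDerivAt (fun z => innerSL ℝ (z - y)) (innerSL ℝ (E := E)) x := by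
    have := (innerSL ℝ (E := E)).hasFDerivAt.comp x (hasFDerivAt_sub_const y)
    rwa [ContinuousLinearMap.comp_id] at this
  have h3 := ((hasFDerivAt_exp_neg_mul_norm_sub_sq α y x).const_mul (-(2 * α))).fun_smul h2
  set b := stdOrthonormalBasis ℝ E
  have hsum : ∑ j, ⟪x - y, b j⟫ ^ 2 = ‖x - y‖ ^ 2 := by
    simpa using b.sum_sq_norm_inner_left (x - y)
  rw [laplacian_eq_sum_fderiv_fderiv b, h1, h3.fderiv]
  have h4 : ∀ j, ⟪b j, b j⟫ = (1 : ℝ) := fun j => by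
    rw [real_inner_self_eq_norm_sq, b.norm_eq_one]; norm_num
  refine (Finset.sum_congr rfl fun j _ => (?_ : _ = Real.exp (-α * ‖x - y‖ ^ 2) *
      (4 * α ^ 2 * ⟪x - y, b j⟫ ^ 2 - 2 * α))).trans ?_
  · change (-(2 * α) * Real.exp (-α * ‖x - y‖ ^ 2)) * ⟪b j, b j⟫ +
      (-(2 * α) * ((-(2 * α) * Real.exp (-α * ‖x - y‖ ^ 2)) * ⟪x - y, b j⟫)) *
        ⟪x - y, b j⟫ = _
    rw [h4]
    ring
  · rw [← Finset.mul_sum, Finset.sum_sub_distrib, ← Finset.mul_sum, hsum]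
    simp
    ring

/-- The Hopf boundary point lemma. -/
theorem ViscositySubharmonicOn.hopf {P : E → ℝ} {Ω : Set E} (hP : ViscositySubharmonicOn P Ω)
    {y x : E} {ρ M : ℝ} (hρ : 0 < ρ) (hball : Metric.ball y ρ ⊆ Ω)
    (hc : ContinuousOn P (Metric.closedBall y ρ)) (hlt : ∀ z ∈ Metric.ball y ρ, P z < M)
    (hle : ∀ z ∈ Metric.closedBall y ρ, P z ≤ M) (hx : ‖x - y‖ = ρ) (hPx : P x = M)
    {P' : E →L[ℝ] ℝ} (hP' : HasFDerivWithinAt P P' (Metric.closedBall y ρ) x) :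
    0 < P' (x - y) := by
  obtain ⟨z₁, hz₁, hz₁max⟩ := (isCompact_closedBall y (ρ / 2)).exists_isMaxOn
    ⟨y, Metric.mem_closedBall_self (by positivity)⟩ (hc.mono (Metric.closedBall_subset_closedBall (by linarith)))
  set ε := M - P z₁ with hε
  have hε0 : 0 < ε := sub_pos.2 (hlt _ (Metric.closedBall_subset_ball (by linarith) hz₁))
  set d : ℝ := (Module.finrank ℝ E : ℝ)
  have hd : 0 ≤ d := Nat.cast_nonneg _
  -- With `αρ² = 2d + 1`, the barrier `V` has positive Laplacian where `|z - y| > ρ/2`, since there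
  -- `4α|z - y|² - 2d > αρ² - 2d = 1`.
  set α := (2 * d + 1) / ρ ^ 2 with hα
  have hα0 : 0 < α := by positivity
  have hαρ : α * ρ ^ 2 = 2 * d + 1 := by rw [hα]; field_simp
  set V : E → ℝ := fun z => Real.exp (-α * ‖z - y‖ ^ 2) with hV
  have hVc : ContDiff ℝ 2 V :=
    (contDiff_const.mul ((contDiff_id.sub contDiff_const).norm_sq ℝ)).exp
  set K : Set E := {z | ρ / 2 ≤ ‖z - y‖ ∧ ‖z - y‖ ≤ ρ} with hK
  have hKsub : K ⊆ Metric.closedBall y ρ := fun z hz => mem_closedBall_iff_norm.2 hz.2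
  have hnc : Continuous fun z : E => ‖z - y‖ := by fun_prop
  have hKc : IsCompact K := (isCompact_closedBall y ρ).of_isClosed_subset
    ((isClosed_le continuous_const hnc).inter (isClosed_le hnc continuous_const)) hKsub
  have hxK : x ∈ K := ⟨by linarith, hx.le⟩
  have hεV : ContDiff ℝ 2 fun z => ε * V z := contDiff_const.mul hVc
  obtain ⟨z₀, hz₀, hz₀max⟩ := hKc.exists_isMaxOn ⟨x, hxK⟩
    (f := fun z => P z + ε * V z) ((hc.mono hKsub).add hεV.continuous.continuousOn)
  have hVx : V x = Real.exp (-α * ρ ^ 2) := by simp only [hV, hx]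
  have hVpos : ∀ z, 0 < V z := fun z => Real.exp_pos _
  -- `P + εV` is maximal over the annulus at `x`. On the outer sphere `V` is constant and `P ≤ M`;
  -- on the inner one `P + εV ≤ (M - ε) + ε`; an interior maximum would contradict viscosity
  -- subharmonicity, as `Δ(εV) > 0`.
  have hmax : IsMaxOn (fun z => P z + ε * V z) K x := by
    suffices h : P z₀ + ε * V z₀ ≤ P x + ε * V x from fun z hz => (hz₀max hz).trans h
    rcases eq_or_lt_of_le hz₀.2 with h1 | h1
    · have : V z₀ = V x := by simp only [hV, hx, h1]
      rw [this, hPx]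
      linarith [hle z₀ (hKsub hz₀)]
    rcases eq_or_lt_of_le hz₀.1 with h2 | h2
    · have h3 : P z₀ ≤ P z₁ := hz₁max (mem_closedBall_iff_norm.2 h2.ge)
      have h4 : V z₀ ≤ 1 := Real.exp_le_one_iff.2 (by nlinarith [sq_nonneg ‖z₀ - y‖])
      have h5 : ε * V z₀ ≤ ε := mul_le_of_le_one_right hε0.le h4
      have h6 := mul_pos hε0 (hVpos x)
      rw [hPx]
      linarith
    · exfalso
      have hnhds : K ∈ 𝓝 z₀ := by
        filter_upwards [hnc.continuousAt.eventually (lt_mem_nhds h2),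
          hnc.continuousAt.eventually (gt_mem_nhds h1)] with z ha hb using ⟨ha.le, hb.le⟩
      have h3 := hP z₀ (hball (mem_ball_iff_norm.2 h1)) (fun z => ε * V z) hεV.contDiffAt
        (hz₀max.isLocalMax hnhds)
      rw [hVc.contDiffAt.laplacian_const_mul, laplacian_exp_neg_mul_norm_sub_sq] at h3
      refine absurd h3 (not_le.2 (mul_pos hε0 (mul_pos (Real.exp_pos _) ?_)))
      have h4 : (ρ / 2) ^ 2 < ‖z₀ - y‖ ^ 2 := by gcongr
      have h5 : 4 * α ^ 2 * ‖z₀ - y‖ ^ 2 - 2 * α * d = α * (4 * (α * ‖z₀ - y‖ ^ 2) - 2 * d) := by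
        ring
      have h6 : α * (ρ / 2) ^ 2 < α * ‖z₀ - y‖ ^ 2 := by gcongr
      rw [h5]
      refine mul_pos hα0 ?_
      nlinarith
  have hderiv := (hP'.mono hKsub).add
    (((hasFDerivAt_exp_neg_mul_norm_sub_sq α y x).const_mul ε).hasFDerivWithinAt (s := K))
  -- Moving from `x` halfway to the centre stays in the annulus; along this direction the derivative
  -- of `P + εV` is nonpositive, while `εV` strictly increases.
  have hcone : (x - (1 / 2 : ℝ) • (x - y)) - x ∈ posTangentConeAt K x := by
    refine sub_mem_posTangentConeAt_of_segment_subset fun z hz => ?_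
    rw [segment_eq_image'] at hz
    obtain ⟨s, hs, rfl⟩ := hz
    have e : x + s • (x - (1 / 2 : ℝ) • (x - y) - x) - y = (1 - s / 2) • (x - y) := by module
    have h1 : 0 ≤ 1 - s / 2 := by linarith [hs.2]
    change _ ≤ ‖_‖ ∧ ‖_‖ ≤ _
    rw [e, norm_smul, hx, Real.norm_eq_abs, abs_of_nonneg h1]
    constructor <;> nlinarith [hs.1, hs.2]
  have hle0 := hmax.localize.hasFDerivWithinAt_nonpos hderiv hcone
  have e2 : (x - (1 / 2 : ℝ) • (x - y)) - x = (-(1 / 2) : ℝ) • (x - y) := by module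
  have e3 : ⟪x - y, x - y⟫ = ρ ^ 2 := by rw [real_inner_self_eq_norm_sq, hx]
  rw [e2, map_smul] at hle0
  have e4 : (P' + ε • (-(2 * α) * Real.exp (-α * ‖x - y‖ ^ 2)) • innerSL ℝ (x - y)) (x - y) =
      P' (x - y) - 2 * (ε * α * V x * ρ ^ 2) := by
    change P' (x - y) + ε * ((-(2 * α) * V x) * ⟪x - y, x - y⟫) = _
    rw [e3]
    ring
  rw [e4, smul_eq_mul] at hle0
  have := hVpos x
  have h7 : 0 < ε * α * V x * ρ ^ 2 := by positivity
  linarith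

/-- The strong maximum principle. -/
theorem ViscositySubharmonicOn.eq_of_exists_eq {P : E → ℝ} {Ω : Set E}
    (hP : ViscositySubharmonicOn P Ω) (hΩ : IsOpen Ω) (hΩc : IsPreconnected Ω)
    (hd : ∀ z ∈ Ω, DifferentiableAt ℝ P z) {M : ℝ} (hle : ∀ z ∈ Ω, P z ≤ M)
    (hex : ∃ z ∈ Ω, P z = M) : ∀ z ∈ Ω, P z = M := by
  have hPc : ContinuousOn P Ω := fun z hz => (hd z hz).continuousAt.continuousWithinAt
  have hopen : IsOpen {z ∈ Ω | P z = M} := by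
    rw [Metric.isOpen_iff]
    rintro c ⟨hcΩ, hcM⟩
    obtain ⟨r, hr, hrΩ⟩ := Metric.isOpen_iff.1 hΩ c hcΩ
    refine ⟨r / 2, by positivity, fun a ha => ?_⟩
    have haΩ : a ∈ Ω := hrΩ (Metric.ball_subset_ball (by linarith) ha)
    refine ⟨haΩ, ?_⟩
    -- If `P a < M`, the largest ball about `a` free of points where `P = M` touches that set at
    -- some `x`. Hopf's lemma gives a nonzero derivative at `x`, which is an interior maximum. The
    -- radius `r / 2` keeps this ball inside `Ω`.
    by_contra hne
    rw [Metric.mem_ball] at ha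
    have hsub : Metric.closedBall a (dist c a) ⊆ Ω := fun z hz => hrΩ (by
      rw [Metric.mem_closedBall] at hz
      rw [Metric.mem_ball]
      have := dist_triangle z a c
      rw [dist_comm c a] at hz
      linarith)
    have hScl : IsCompact (Metric.closedBall a (dist c a) ∩ P ⁻¹' {M}) :=
      (isCompact_closedBall a _).of_isClosed_subset
        ((hPc.mono hsub).preimage_isClosed_of_isClosed Metric.isClosed_closedBall
          isClosed_singleton) inter_subset_left
    obtain ⟨x, ⟨hxb, hxM⟩, hxmin⟩ := hScl.exists_isMinOn (f := fun z => dist z a)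
      ⟨c, by simp, hcM⟩ (by fun_prop)
    have hxΩ := hsub hxb
    have hxM : P x = M := hxM
    have hρ : 0 < dist x a := dist_pos.2 fun h => hne (h ▸ hxM)
    have hsub2 : Metric.closedBall a (dist x a) ⊆ Ω :=
      (Metric.closedBall_subset_closedBall hxb).trans hsub
    have h := hP.hopf (y := a) (x := x) (M := M) hρ (Metric.ball_subset_closedBall.trans hsub2)
      (hPc.mono hsub2) (fun z hz => lt_of_le_of_ne
          (hle z (hsub2 (Metric.ball_subset_closedBall hz))) fun hzM => by
        have h1 : dist x a ≤ dist z a :=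
          hxmin ⟨(Metric.mem_ball.1 hz).le.trans (Metric.mem_closedBall.1 hxb), hzM⟩
        exact absurd (Metric.mem_ball.1 hz) (not_lt.2 h1))
      (fun z hz => hle z (hsub2 hz)) (dist_eq_norm x a).symm hxM
      (hd x hxΩ).hasFDerivAt.hasFDerivWithinAt
    have hmax : IsLocalMax P x := by
      filter_upwards [hΩ.mem_nhds hxΩ] with z hz
      rw [hxM]
      exact hle z hz
    rw [hmax.fderiv_eq_zero] at h
    simp at h
  obtain ⟨c, hcΩ, hcM⟩ := hex
  have hsub := hΩc.subset_left_of_subset_union hopen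
    (hPc.isOpen_inter_preimage hΩ (isOpen_Iio (a := M))) (by
      rw [Set.disjoint_left]
      rintro z ⟨-, h1⟩ ⟨-, h2⟩
      exact absurd h1 (ne_of_lt h2))
    (fun z hz => (eq_or_lt_of_le (hle z hz)).imp (fun h => ⟨hz, h⟩) fun h => ⟨hz, h⟩)
    ⟨c, hcΩ, hcΩ, hcM⟩
  exact fun z hz => (hsub hz).2

end Hopf

/-! ### The `P`-function: subharmonicity, boundary estimate, constancy -/

namespace RobinTorsion

open Laplacian

variable {N : ℕ} {Ω : Set (Euc N)} {u : Euc N → ℝ}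

theorem contDiffOn_fderivWithin_closure (hΩ : IsOpen Ω) (h2 : HasC2Boundary Ω)
    (hu : ContDiffOn ℝ 2 u (closure Ω)) :
    ContDiffOn ℝ 1 (fderivWithin ℝ u (closure Ω)) (closure Ω) :=
  hu.fderivWithin (h2.uniqueDiffOn_closure hΩ) (by norm_num)

theorem contDiffOn_grad (hΩ : IsOpen Ω) (h2 : HasC2Boundary Ω)
    (hu : ContDiffOn ℝ 2 u (closure Ω)) : ContDiffOn ℝ 1 (grad Ω u) (closure Ω) :=
  (InnerProductSpace.toDual ℝ (Euc N)).symm.toContinuousLinearEquiv.contDiff.comp_contDiffOn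
    (contDiffOn_fderivWithin_closure hΩ h2 hu)

theorem hasFDerivWithinAt_grad (hΩ : IsOpen Ω) (h2 : HasC2Boundary Ω)
    (hu : ContDiffOn ℝ 2 u (closure Ω)) {x : Euc N} (hx : x ∈ closure Ω) :
    HasFDerivWithinAt (grad Ω u) (hess Ω u x) (closure Ω) x :=
  ((contDiffOn_grad hΩ h2 hu).differentiableOn (by norm_num) x hx).hasFDerivWithinAt

theorem inner_hess (hΩ : IsOpen Ω) (h2 : HasC2Boundary Ω)
    (hu : ContDiffOn ℝ 2 u (closure Ω)) {x : Euc N} (hx : x ∈ closure Ω) (v w : Euc N) :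
    ⟪hess Ω u x v, w⟫ =
      fderivWithin ℝ (fderivWithin ℝ u (closure Ω)) (closure Ω) x v w :=
  inner_fderivWithin_gradientWithin (h2.uniqueDiffOn_closure hΩ x hx)
    ((contDiffOn_grad hΩ h2 hu).differentiableOn (by norm_num) x hx)
    ((contDiffOn_fderivWithin_closure hΩ h2 hu).differentiableOn (by norm_num) x hx) v w

theorem inner_hess_comm (hΩ : IsOpen Ω) (h2 : HasC2Boundary Ω)
    (hu : ContDiffOn ℝ 2 u (closure Ω)) {x : Euc N} (hx : x ∈ closure Ω) (v w : Euc N) :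
    ⟪hess Ω u x v, w⟫ = ⟪hess Ω u x w, v⟫ := by
  rw [inner_hess hΩ h2 hu hx, inner_hess hΩ h2 hu hx]
  -- Symmetry of second derivatives extends to the boundary because every point of the closure is a
  -- limit of interior points.
  have hx' : x ∈ closure (interior (closure Ω)) :=
    closure_mono (hΩ.subset_interior_closure) hx
  exact ((hu x hx).isSymmSndFDerivWithinAt (by simp) (h2.uniqueDiffOn_closure hΩ) hx' hx).eq v w

theorem inner_grad_of_mem (hΩ : IsOpen Ω) {x : Euc N} (hx : x ∈ Ω) (v : Euc N) :
    ⟪grad Ω u x, v⟫ = fderiv ℝ u x v := by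
  rw [grad, inner_gradientWithin_left,
    fderivWithin_of_mem_nhds (mem_of_superset (hΩ.mem_nhds hx) subset_closure)]

theorem inner_hess_of_mem (hΩ : IsOpen Ω) (h2 : HasC2Boundary Ω)
    (hu : ContDiffOn ℝ 2 u (closure Ω)) {x : Euc N} (hx : x ∈ Ω) (v w : Euc N) :
    ⟪hess Ω u x v, w⟫ = fderiv ℝ (fderiv ℝ u) x v w := by
  have hn : ∀ y ∈ Ω, closure Ω ∈ 𝓝 y := fun y hy =>
    mem_of_superset (hΩ.mem_nhds hy) subset_closure
  rw [inner_hess hΩ h2 hu (subset_closure hx), fderivWithin_of_mem_nhds (hn x hx)]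
  have : fderivWithin ℝ u (closure Ω) =ᶠ[𝓝 x] fderiv ℝ u := by
    filter_upwards [hΩ.mem_nhds hx] with y hy using fderivWithin_of_mem_nhds (hn y hy)
  rw [this.fderiv_eq]

/-- The `P`-function `|∇u|² - 2u`. -/
noncomputable def pFunction (Ω : Set (Euc N)) (u : Euc N → ℝ) (x : Euc N) : ℝ :=
  ‖grad Ω u x‖ ^ 2 - 2 * u x

/-- The differential of the `P`-function. -/
noncomputable def pFunctionDeriv (Ω : Set (Euc N)) (u : Euc N → ℝ) (x : Euc N) : Euc N →L[ℝ] ℝ :=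
  (2 : ℝ) • (innerSL ℝ (grad Ω u x)).comp (hess Ω u x) -
    (2 : ℝ) • fderivWithin ℝ u (closure Ω) x

theorem pFunctionDeriv_apply (x v : Euc N) : pFunctionDeriv Ω u x v =
    2 * ⟪grad Ω u x, hess Ω u x v⟫ - 2 * ⟪grad Ω u x, v⟫ := by
  have : ⟪grad Ω u x, v⟫ = fderivWithin ℝ u (closure Ω) x v := inner_gradientWithin_left
  rw [this]
  rfl

theorem hasFDerivWithinAt_pFunction (hΩ : IsOpen Ω) (h2 : HasC2Boundary Ω)
    (hu : ContDiffOn ℝ 2 u (closure Ω)) {x : Euc N} (hx : x ∈ closure Ω) :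
    HasFDerivWithinAt (pFunction Ω u) (pFunctionDeriv Ω u x) (closure Ω) x := by
  have h1 := (hu.differentiableOn (by norm_num) x hx).hasFDerivWithinAt.const_mul (2 : ℝ)
  refine ((hasFDerivWithinAt_grad hΩ h2 hu hx).norm_sq.sub h1).congr_fderiv ?_
  ext v
  simp [pFunctionDeriv]

theorem continuousOn_pFunction (hΩ : IsOpen Ω) (h2 : HasC2Boundary Ω)
    (hu : ContDiffOn ℝ 2 u (closure Ω)) : ContinuousOn (pFunction Ω u) (closure Ω) :=
  fun _ hx => (hasFDerivWithinAt_pFunction hΩ h2 hu hx).continuousWithinAt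

theorem pFunction_eq_of_mem (hΩ : IsOpen Ω) {x : Euc N} (hx : x ∈ Ω) :
    pFunction Ω u x =
      ∑ i, fderiv ℝ u x (EuclideanSpace.basisFun (Fin N) ℝ i) ^ 2 - 2 * u x := by
  rw [pFunction, ← (EuclideanSpace.basisFun (Fin N) ℝ).sum_sq_norm_inner_left (grad Ω u x)]
  simp only [Real.norm_eq_abs, sq_abs, inner_grad_of_mem hΩ hx]

theorem sum_sq_sub_one_eq {H : Fin N → Fin N → ℝ} (hH : ∑ i, H i i = N) :
    ∑ i, ∑ j, (H i j - if i = j then 1 else 0) ^ 2 = ∑ i, ∑ j, H i j ^ 2 - N := by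
  have h : ∀ i j, (H i j - if i = j then 1 else 0) ^ 2 =
      H i j ^ 2 - 2 * (if i = j then H i j else 0) + if i = j then 1 else 0 := by
    intro i j
    split_ifs <;> ring
  simp only [h, Finset.sum_add_distrib, Finset.sum_sub_distrib, ← Finset.mul_sum]
  simp [hH]
  ring

/-- The square `|∇²u - I|²` is kept because it serves twice: dropping it gives subharmonicity, and
taking `w = 0` when `P` is constant forces `∇²u = I`. -/
theorem sum_hessian_le_of_isLocalMax (hΩ : IsOpen Ω) (hu : ContDiffOn ℝ 2 u (closure Ω))
    (hΔ : ∀ x ∈ Ω, Δ u x = (N : ℝ)) {p : Euc N} (hp : p ∈ Ω) {w : Euc N → ℝ}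
    (hw : ContDiffAt ℝ 2 w p) (hmax : IsLocalMax (fun x => pFunction Ω u x + w x) p) :
    2 * ∑ i, ∑ j, (fderiv ℝ (fderiv ℝ u) p (EuclideanSpace.basisFun (Fin N) ℝ i)
      (EuclideanSpace.basisFun (Fin N) ℝ j) - if i = j then 1 else 0) ^ 2 + Δ w p ≤ 0 := by
  set b := EuclideanSpace.basisFun (Fin N) ℝ
  have heq : (fun x => pFunction Ω u x + w x) =ᶠ[𝓝 p]
      fun x => ∑ i, fderiv ℝ u x (b i) ^ 2 - 2 * u x + w x := by
    filter_upwards [hΩ.mem_nhds hp] with x hx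
    rw [pFunction_eq_of_mem hΩ hx]
  have h := formal_laplacian_nonpos_of_localMax b hΩ (hu.mono subset_closure) hΔ hp hw
    (hmax.congr heq)
  have htr := hΔ p hp
  rw [laplacian_eq_sum_fderiv_fderiv b] at htr
  rw [sum_sq_sub_one_eq htr]
  linarith

theorem viscositySubharmonicOn_pFunction (hΩ : IsOpen Ω) (hu : ContDiffOn ℝ 2 u (closure Ω))
    (hΔ : ∀ x ∈ Ω, Δ u x = (N : ℝ)) : ViscositySubharmonicOn (pFunction Ω u) Ω := by
  intro p hp w hw hmax
  have h := sum_hessian_le_of_isLocalMax hΩ hu hΔ hp hw hmax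
  have h0 : 0 ≤ ∑ i, ∑ j, (fderiv ℝ (fderiv ℝ u) p (EuclideanSpace.basisFun (Fin N) ℝ i)
      (EuclideanSpace.basisFun (Fin N) ℝ j) - if i = j then 1 else 0) ^ 2 :=
    Finset.sum_nonneg fun i _ => Finset.sum_nonneg fun j _ => sq_nonneg _
  linarith

/-- The Robin condition is differentiated along the tangential gradient `τ` itself. The term `⟪∇u,
D_τ ν⟫` sees only `τ`, as `D_τ ν` is tangent, and symmetry of the Hessian turns `⟪∇²u τ, ν⟫` into
the normal derivative of `P`. -/
theorem pFunctionDeriv_normal_le {β : ℝ} (hΩ : IsOpen Ω) (hΩb : Bornology.IsBounded Ω)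
    (h2 : HasC2Boundary Ω) (hu : IsRobinTorsionSolution Ω β u) {x : Euc N} (hx : x ∈ frontier Ω)
    (hνν : ⟪hess Ω u x (outerNormal Ω x), outerNormal Ω x⟫ = (1 : ℝ)) :
    pFunctionDeriv Ω u x (outerNormal Ω x) ≤ -2 * (kappaMin Ω + β) *
      ‖grad Ω u x - ⟪grad Ω u x, outerNormal Ω x⟫ • outerNormal Ω x‖ ^ 2 := by
  obtain ⟨A, hA, hAν, hAκ⟩ := h2.exists_hasFDerivWithinAt_outerNormal hΩ hΩb hx
  have hxc : x ∈ closure Ω := frontier_subset_closure hx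
  have hn := h2.isOuterUnitNormal hΩ hx
  have hG := hasFDerivWithinAt_grad hΩ h2 hu.contDiffOn hxc
  have hU := ((hu.contDiffOn.differentiableOn (by norm_num)) x hxc).hasFDerivWithinAt
  set ν := outerNormal Ω x with hνdef
  set G := grad Ω u x with hGdef
  set H := hess Ω u x
  set a := ⟪G, ν⟫ with ha
  set τ := G - a • ν with hτ
  have hτν : ⟪τ, ν⟫ = (0 : ℝ) := by
    rw [hτ, inner_sub_left, real_inner_smul_left, hn.inner_self, ← ha]; ring
  have hrobin := ((hG.mono frontier_subset_closure).inner ℝ hA).add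
    ((hU.mono frontier_subset_closure).const_mul β)
  have hzero : HasFDerivWithinAt (fun y => ⟪grad Ω u y, outerNormal Ω y⟫ + β * u y)
      (0 : Euc N →L[ℝ] ℝ) (frontier Ω) x :=
    (hasFDerivWithinAt_const (0 : ℝ) x _).congr (fun y hy => hu.robin y hy) (hu.robin x hx)
  have htan := hrobin.unique_on hzero (hn.mem_tangentConeAt_frontier hΩ hτν)
  have htan' : ⟪G, A τ⟫ + ⟪H τ, ν⟫ + β * ⟪G, τ⟫ = 0 := by
    have e : ⟪G, τ⟫ = fderivWithin ℝ u (closure Ω) x τ := inner_gradientWithin_left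
    rw [e]
    simpa using htan
  have hGτ : G = τ + a • ν := by rw [hτ]; abel
  have e1 : ⟪G, A τ⟫ = ⟪A τ, τ⟫ := by
    rw [hGτ, inner_add_left, real_inner_smul_left, real_inner_comm, real_inner_comm (A τ) ν, hAν]
    ring
  have e2 : ⟪G, τ⟫ = ‖τ‖ ^ 2 := by
    rw [hGτ, inner_add_left, real_inner_smul_left, real_inner_comm τ ν, hτν,
      real_inner_self_eq_norm_sq]
    ring
  have e3 : ⟪H τ, ν⟫ = ⟪H ν, τ⟫ := inner_hess_comm hΩ h2 hu.contDiffOn hxc τ ν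
  have e4 : ⟪G, H ν⟫ = ⟪H ν, τ⟫ + a := by
    -- Here `⟪∇²u ν, ν⟫ = 1` enters: the contribution of `a • ν` is exactly `a`, cancelling the
    -- derivative of `-2u`.
    rw [hGτ, real_inner_comm, inner_add_right, real_inner_smul_right, hνν]
    ring
  rw [pFunctionDeriv_apply, ← hGdef, e4, ← ha]
  rw [e1, e2, e3] at htan'
  have := hAκ τ hτν
  linarith

/-- A maximum attained in `Ω` is handled by the strong maximum principle. Otherwise an interior ball
touching the boundary at the maximum gives a positive normal derivative, against the boundary
estimate. -/
theorem pFunction_eq_const {β : ℝ} (hΩ : IsOpen Ω) (hΩc : IsConnected Ω)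
    (hΩb : Bornology.IsBounded Ω) (h2 : HasC2Boundary Ω) (hu : IsRobinTorsionSolution Ω β u)
    (hνν : ∀ x ∈ frontier Ω, ⟪hess Ω u x (outerNormal Ω x), outerNormal Ω x⟫ = (1 : ℝ))
    (hκ : 0 < kappaMin Ω + β) : ∃ M, ∀ x ∈ closure Ω, pFunction Ω u x = M := by
  have hc := continuousOn_pFunction hΩ h2 hu.contDiffOn
  have hsub := viscositySubharmonicOn_pFunction hΩ hu.contDiffOn hu.laplacian_eq
  have hcomp : IsCompact (closure Ω) :=
    Metric.isCompact_of_isClosed_isBounded isClosed_closure hΩb.closure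
  obtain ⟨x₀, hx₀, hmax⟩ := hcomp.exists_isMaxOn hΩc.nonempty.closure hc
  have hle : ∀ z ∈ closure Ω, pFunction Ω u z ≤ pFunction Ω u x₀ := fun z hz => hmax hz
  refine ⟨pFunction Ω u x₀, ?_⟩
  have hd : ∀ z ∈ Ω, DifferentiableAt ℝ (pFunction Ω u) z := fun z hz =>
    ((hasFDerivWithinAt_pFunction hΩ h2 hu.contDiffOn (subset_closure hz)).hasFDerivAt
      (mem_of_superset (hΩ.mem_nhds hz) subset_closure)).differentiableAt
  by_cases hex : ∃ z ∈ Ω, pFunction Ω u z = pFunction Ω u x₀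
  · have hconst := hsub.eq_of_exists_eq hΩ hΩc.isPreconnected hd
      (fun z hz => hle z (subset_closure hz)) hex
    have := Set.EqOn.of_subset_closure (f := pFunction Ω u) (g := fun _ => pFunction Ω u x₀)
      hconst hc continuousOn_const subset_closure subset_rfl
    exact this
  · exfalso
    push Not at hex
    have hx₀Ω : x₀ ∉ Ω := fun h => hex x₀ h rfl
    have hxf : x₀ ∈ frontier Ω := by rw [hΩ.frontier_eq]; exact ⟨hx₀, hx₀Ω⟩
    have hn := h2.isOuterUnitNormal hΩ hxf
    obtain ⟨ρ, hρ, hball⟩ := h2.exists_ball_subset hΩ hxf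
    have hcl : Metric.closedBall (x₀ - ρ • outerNormal Ω x₀) ρ ⊆ closure Ω := by
      rw [← closure_ball _ hρ.ne']
      exact closure_mono hball
    have h := hsub.hopf (x := x₀) (M := pFunction Ω u x₀) hρ hball (hc.mono hcl)
      (fun z hz => lt_of_le_of_ne (hle z (subset_closure (hball hz))) (hex z (hball hz)))
      (fun z hz => hle z (hcl hz))
      (by rw [sub_sub_cancel, norm_smul, hn.norm_eq_one, Real.norm_eq_abs, abs_of_pos hρ, mul_one])
      rfl ((hasFDerivWithinAt_pFunction hΩ h2 hu.contDiffOn hx₀).mono hcl)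
    rw [sub_sub_cancel, map_smul, smul_eq_mul] at h
    have h1 := pos_of_mul_pos_right h hρ.le
    have h2 := pFunctionDeriv_normal_le hΩ hΩb h2 hu hxf (hνν x₀ hxf)
    have h3 := mul_nonneg hκ.le
      (sq_nonneg ‖grad Ω u x₀ - ⟪grad Ω u x₀, outerNormal Ω x₀⟫ • outerNormal Ω x₀‖)
    linarith

/-- If the `P`-function is constant, then `u` is a quadratic polynomial. -/
theorem exists_eq_quadratic_of_pFunction_const (hΩ : IsOpen Ω) (hΩc : IsConnected Ω)
    (h2 : HasC2Boundary Ω) (hu : ContDiffOn ℝ 2 u (closure Ω))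
    (hΔ : ∀ x ∈ Ω, Δ u x = (N : ℝ)) {M : ℝ} (hP : ∀ x ∈ Ω, pFunction Ω u x = M) :
    ∃ (z : Euc N) (c : ℝ), ∀ x ∈ closure Ω, grad Ω u x = x - z ∧ u x = ‖x - z‖ ^ 2 / 2 + c := by
  set b := EuclideanSpace.basisFun (Fin N) ℝ
  have hn : ∀ y ∈ Ω, closure Ω ∈ 𝓝 y := fun y hy =>
    mem_of_superset (hΩ.mem_nhds hy) subset_closure
  have hhess : ∀ p ∈ Ω, hess Ω u p = ContinuousLinearMap.id ℝ (Euc N) := by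
    intro p hp
    have hmax : IsLocalMax (fun x => pFunction Ω u x + (fun _ => (0 : ℝ)) x) p := by
      filter_upwards [hΩ.mem_nhds hp] with x hx
      rw [hP x hx, hP p hp]
    have h := sum_hessian_le_of_isLocalMax hΩ hu hΔ hp contDiffAt_const hmax
    have h0 : Δ (fun _ : Euc N => (0 : ℝ)) p = 0 :=
      congrFun (InnerProductSpace.laplacian_const (E := Euc N) (c := (0 : ℝ))) p
    rw [h0] at h
    have hnn : ∀ i j, 0 ≤ (fderiv ℝ (fderiv ℝ u) p (b i) (b j) - if i = j then 1 else 0) ^ 2 :=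
      fun i j => sq_nonneg _
    have hz : ∑ i, ∑ j, (fderiv ℝ (fderiv ℝ u) p (b i) (b j) - if i = j then 1 else 0) ^ 2 = 0 :=
      le_antisymm (by linarith)
        (Finset.sum_nonneg fun i _ => Finset.sum_nonneg fun j _ => hnn i j)
    have hij : ∀ i j, fderiv ℝ (fderiv ℝ u) p (b i) (b j) = if i = j then 1 else 0 := by
      intro i j
      have h1 := (Finset.sum_eq_zero_iff_of_nonneg fun i _ =>
        Finset.sum_nonneg fun j _ => hnn i j).1 hz i (Finset.mem_univ _)
      have h3 := (Finset.sum_eq_zero_iff_of_nonneg fun j _ => hnn i j).1 h1 j (Finset.mem_univ _)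
      exact sub_eq_zero.1 (pow_eq_zero_iff (two_ne_zero)|>.1 h3)
    refine ContinuousLinearMap.coe_injective (b.toBasis.ext fun i => ?_)
    refine InnerProductSpace.ext_inner_right_basis b.toBasis fun j => ?_
    have e : ⟪b i, b j⟫ = if i = j then (1 : ℝ) else 0 := orthonormal_iff_ite.1 b.orthonormal i j
    simp only [OrthonormalBasis.coe_toBasis, ContinuousLinearMap.coe_coe,
      ContinuousLinearMap.id_apply]
    rw [inner_hess_of_mem hΩ h2 hu hp, hij, e]
  have hG : ∀ x ∈ Ω, HasFDerivAt (grad Ω u) (ContinuousLinearMap.id ℝ (Euc N)) x := by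
    intro x hx
    rw [← hhess x hx]
    exact (hasFDerivWithinAt_grad hΩ h2 hu (subset_closure hx)).hasFDerivAt (hn x hx)
  obtain ⟨x₀, hx₀⟩ := hΩc.nonempty
  have hGd : ∀ x ∈ Ω, HasFDerivAt (fun y => grad Ω u y - y) (0 : Euc N →L[ℝ] Euc N) x := by
    intro x hx
    have := (hG x hx).sub (hasFDerivAt_id x)
    rwa [sub_self] at this
  have hGc : ∀ x ∈ Ω, grad Ω u x - x = grad Ω u x₀ - x₀ := fun x hx =>
    hΩ.is_const_of_fderiv_eq_zero (𝕜 := ℝ) (f := fun y => grad Ω u y - y) hΩc.isPreconnected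
      (fun y hy => (hGd y hy).differentiableAt.differentiableWithinAt)
      (fun y hy => (hGd y hy).fderiv) hx hx₀
  set z := x₀ - grad Ω u x₀ with hz
  have hGz : ∀ x ∈ Ω, grad Ω u x = x - z := by
    intro x hx
    have := hGc x hx
    rw [sub_eq_iff_eq_add] at this
    rw [this, hz]
    abel
  have hud : ∀ x ∈ Ω, HasFDerivAt (fun y => u y - ‖y - z‖ ^ 2 / 2) (0 : Euc N →L[ℝ] ℝ) x := by
    intro x hx
    have h1 : HasFDerivAt u (fderiv ℝ u x) x :=
      ((hu.contDiffAt (hn x hx)).differentiableAt (by norm_num)).hasFDerivAt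
    have h3 : HasFDerivAt (fun y => ‖y - z‖ ^ 2) _ x := (hasFDerivAt_sub_const z).norm_sq
    refine (h1.sub (h3.mul_const (2 : ℝ)⁻¹)).congr_fderiv ?_
    ext v
    have e := inner_grad_of_mem (u := u) hΩ hx v
    rw [hGz x hx] at e
    simp [← e, inner_sub_left]
  have huc : ∀ x ∈ Ω, u x - ‖x - z‖ ^ 2 / 2 = u x₀ - ‖x₀ - z‖ ^ 2 / 2 := fun x hx =>
    hΩ.is_const_of_fderiv_eq_zero (𝕜 := ℝ) (f := fun y => u y - ‖y - z‖ ^ 2 / 2)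
      hΩc.isPreconnected (fun y hy => (hud y hy).differentiableAt.differentiableWithinAt)
      (fun y hy => (hud y hy).fderiv) hx hx₀
  refine ⟨z, u x₀ - ‖x₀ - z‖ ^ 2 / 2, fun x hx => ⟨?_, ?_⟩⟩
  · exact Set.EqOn.of_subset_closure (f := grad Ω u) (g := fun y => y - z) hGz
      (contDiffOn_grad hΩ h2 hu).continuousOn (by fun_prop) subset_closure subset_rfl hx
  · exact Set.EqOn.of_subset_closure (f := u)
      (g := fun y => ‖y - z‖ ^ 2 / 2 + (u x₀ - ‖x₀ - z‖ ^ 2 / 2))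
      (fun y hy => by rw [← huc y hy]; ring) hu.continuousOn (by fun_prop)
      subset_closure subset_rfl hx

/-- For constant `P` the normal derivative vanishes, so the boundary estimate leaves no room for a
tangential gradient when `κ_min + β > 0`. -/
theorem grad_eq_smul_normal_of_pFunction_const {β : ℝ} (hΩ : IsOpen Ω)
    (hΩb : Bornology.IsBounded Ω) (h2 : HasC2Boundary Ω) (hu : IsRobinTorsionSolution Ω β u)
    (hκ : 0 < kappaMin Ω + β) {M : ℝ} (hP : ∀ x ∈ closure Ω, pFunction Ω u x = M) {x : Euc N}
    (hx : x ∈ frontier Ω)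
    (hνν : ⟪hess Ω u x (outerNormal Ω x), outerNormal Ω x⟫ = (1 : ℝ)) :
    grad Ω u x = ⟪grad Ω u x, outerNormal Ω x⟫ • outerNormal Ω x := by
  have hxc : x ∈ closure Ω := frontier_subset_closure hx
  have hzero : HasFDerivWithinAt (pFunction Ω u) (0 : Euc N →L[ℝ] ℝ) (closure Ω) x :=
    (hasFDerivWithinAt_const M x _).congr hP (hP x hxc)
  have h0 := (h2.uniqueDiffOn_closure hΩ x hxc).eq
    (hasFDerivWithinAt_pFunction hΩ h2 hu.contDiffOn hxc) hzero
  have h := pFunctionDeriv_normal_le hΩ hΩb h2 hu hx hνν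
  rw [h0] at h
  simp only [zero_apply] at h
  by_contra hne
  have hpos := norm_pos_iff.2 (sub_ne_zero.2 hne)
  have := mul_pos hκ (pow_pos hpos 2)
  linarith

/-! ### Rigidity: the domain is a ball -/

theorem exists_ne_zero_inner_eq_zero (hN : 2 ≤ N) (n : Euc N) :
    ∃ v : Euc N, v ≠ 0 ∧ ⟪v, n⟫ = (0 : ℝ) := by
  have h1 := Submodule.finrank_add_finrank_orthogonal (ℝ ∙ n)
  have h2 : Module.finrank ℝ (ℝ ∙ n) ≤ 1 := by
    simpa using finrank_span_le_card (R := ℝ) ({n} : Set (Euc N))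
  rw [finrank_euclideanSpace_fin] at h1
  have h3 : (ℝ ∙ n)ᗮ ≠ ⊥ := fun h => by
    rw [h, finrank_bot] at h1
    omega
  obtain ⟨v, hv, hv0⟩ := Submodule.exists_mem_ne_zero_of_ne_bot h3
  exact ⟨v, hv0, (Submodule.mem_orthogonal_singleton_iff_inner_left).1 hv⟩

/-- A domain whose position vector is normal to the boundary, with normal component a root of a
fixed quadratic polynomial, is a ball. -/
theorem eq_ball_of_position_normal {β c : ℝ} {z : Euc N} (hN : 2 ≤ N) (hΩ : IsOpen Ω)
    (hne : Ω.Nonempty) (hΩb : Bornology.IsBounded Ω) (h2 : HasC2Boundary Ω)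
    (hκ : 0 < kappaMin Ω + β)
    (hpos : ∀ x ∈ frontier Ω, x - z = ⟪x - z, outerNormal Ω x⟫ • outerNormal Ω x)
    (hroot : ∀ x ∈ frontier Ω, ⟪x - z, outerNormal Ω x⟫ + β * (‖x - z‖ ^ 2 / 2 + c) = 0) :
    ∃ R : ℝ, 0 < R ∧ Ω = Metric.ball z R := by
  have : Nontrivial (Euc N) := by
    obtain ⟨v, hv, -⟩ := exists_ne_zero_inner_eq_zero hN (0 : Euc N)
    exact ⟨v, 0, hv⟩
  have hcomp : IsCompact (closure Ω) :=
    Metric.isCompact_of_isClosed_isBounded isClosed_closure hΩb.closure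
  obtain ⟨x₀, hx₀, hmax⟩ := hcomp.exists_isMaxOn hne.closure (f := fun x => ‖x - z‖) (by fun_prop)
  set R := ‖x₀ - z‖ with hR
  have hle : ∀ x ∈ closure Ω, ‖x - z‖ ≤ R := fun x hx => hmax hx
  have hsub : Ω ⊆ Metric.ball z R := by
    rw [← interior_closedBall']
    exact interior_maximal
      (fun x hx => mem_closedBall_iff_norm.2 (hle x (subset_closure hx))) hΩ
  have hR0 : 0 < R := by
    obtain ⟨y, hy⟩ := hne
    exact (norm_nonneg _).trans_lt (mem_ball_iff_norm.1 (hsub hy))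
  have hx₀f : x₀ ∈ frontier Ω := by
    rw [hΩ.frontier_eq]
    exact ⟨hx₀, fun h => lt_irrefl R (mem_ball_iff_norm.1 (hsub h))⟩
  have habs : ∀ x ∈ frontier Ω, |⟪x - z, outerNormal Ω x⟫| = ‖x - z‖ := by
    intro x hx
    conv_rhs => rw [hpos x hx]
    rw [norm_smul, (h2.isOuterUnitNormal hΩ hx).norm_eq_one, mul_one, Real.norm_eq_abs]
  -- At a farthest point the normal cannot point towards `z`: otherwise the direction `x - z` would
  -- enter `Ω` while leaving the ball that contains it.
  have hout : ∀ x ∈ frontier Ω, ‖x - z‖ = R → ⟪x - z, outerNormal Ω x⟫ = R := by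
    intro x hx hxR
    rcases eq_or_eq_neg_of_abs_eq ((habs x hx).trans hxR) with h | h
    · exact h
    · exfalso
      obtain ⟨t, ht, ht0⟩ := (((h2.isOuterUnitNormal hΩ hx).enters (x - z)
        (by rw [h]; linarith)).and self_mem_nhdsWithin).exists
      have ht0 : 0 < t := ht0
      have h1 := mem_ball_iff_norm.1 (hsub ht)
      have e : x + t • (x - z) - z = (1 + t) • (x - z) := by module
      rw [e, norm_smul, hxR, Real.norm_eq_abs, abs_of_pos (by linarith)] at h1
      nlinarith
  -- The normal components at `x` and at `x₀` solve the same quadratic equation; subtracting and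
  -- dividing by their difference gives the sum of the roots.
  have hother : ∀ x ∈ frontier Ω, ‖x - z‖ ≠ R → β * (⟪x - z, outerNormal Ω x⟫ + R) = -2 := by
    intro x hx hxR
    have h1 := hroot x hx
    have h3 := hroot x₀ hx₀f
    rw [hout x₀ hx₀f rfl, ← hR] at h3
    rw [← habs x hx, sq_abs] at h1
    have hsR : ⟪x - z, outerNormal Ω x⟫ - R ≠ 0 := by
      intro h
      refine hxR ?_
      rw [← habs x hx, sub_eq_zero.1 h, abs_of_pos hR0]
    have h4 : (⟪x - z, outerNormal Ω x⟫ - R) * (β * (⟪x - z, outerNormal Ω x⟫ + R) + 2) = 0 := by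
      linear_combination 2 * h1 - 2 * h3
    linarith [(mul_eq_zero.1 h4).resolve_left hsR]
  have hall : ∀ x ∈ frontier Ω, ‖x - z‖ = R := by
    by_contra! hcon
    obtain ⟨x₁, hx₁, hx₁R⟩ := hcon
    have hlt : ‖x₁ - z‖ < R := lt_of_le_of_ne (hle x₁ (frontier_subset_closure hx₁)) hx₁R
    have hb1 := hother x₁ hx₁ hx₁R
    set s := ⟪x₁ - z, outerNormal Ω x₁⟫ with hs
    have hsabs : |s| < R := (habs x₁ hx₁).trans_lt hlt
    obtain ⟨hs1, hs2⟩ := abs_lt.1 hsabs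
    have hβ0 : β ≠ 0 := by
      rintro rfl
      norm_num at hb1
    -- Near `x₀` one has `|y - z| > |s|`, so the second root `s` is excluded and the frontier lies
    -- on the sphere of radius `R`. Hence `1/R` is a principal curvature at `x₀`.
    have hloc : ∀ᶠ y in 𝓝[frontier Ω] x₀, outerNormal Ω y = R⁻¹ • (y - z) := by
      have hcont : Continuous fun y : Euc N => ‖y - z‖ := by fun_prop
      filter_upwards [self_mem_nhdsWithin, nhdsWithin_le_nhds
        (hcont.continuousAt.eventually (lt_mem_nhds (a := |s|) hsabs))] with y hy hys
      have hyR : ‖y - z‖ = R := by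
        by_contra hne'
        have h1 := hother y hy hne'
        have h3 : ⟪y - z, outerNormal Ω y⟫ = s := by
          have := mul_left_cancel₀ hβ0 (h1.trans hb1.symm)
          linarith
        have h4 := habs y hy
        rw [h3] at h4
        exact absurd h4 (ne_of_lt hys)
      have h5 := hpos y hy
      rw [hout y hy hyR] at h5
      rw [h5, smul_smul, inv_mul_cancel₀ hR0.ne', one_smul]
    have hcurv : IsPrincipalCurvature Ω x₀ R⁻¹ := by
      obtain ⟨v, hv0, hv⟩ := exists_ne_zero_inner_eq_zero hN (outerNormal Ω x₀)
      refine ⟨R⁻¹ • ContinuousLinearMap.id ℝ (Euc N), ?_, v, hv0, hv, rfl⟩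
      exact ((hasFDerivAt_sub_const z).const_smul R⁻¹).hasFDerivWithinAt.congr_of_eventuallyEq hloc
        (hloc.self_of_nhdsWithin hx₀f)
    have hκle : kappaMin Ω ≤ R⁻¹ :=
      csInf_le (h2.bddBelow_principalCurvature hΩ hΩb) ⟨x₀, hx₀f, hcurv⟩
    have h1 : 0 < R⁻¹ + β := by linarith
    have h3 : 0 < 1 + β * R := by
      have := mul_pos hR0 h1
      rwa [mul_add, mul_inv_cancel₀ hR0.ne', mul_comm R β] at this
    -- From `β(s + R) = -2` and `s + R > 0` follows `β < 0`. Then `s < R` gives `-2 = β(s + R) >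
    -- 2βR`, contradicting `1 + βR > 0`.
    have hβneg : β < 0 := by
      by_contra! h
      nlinarith
    nlinarith
  refine ⟨R, hR0, hsub.antisymm ?_⟩
  -- The frontier lies on the sphere, so the connected open ball misses it and, meeting `Ω`, is
  -- contained in it.
  refine (convex_ball z R).isPreconnected.subset_of_disjoint_frontier hΩ ?_ ?_
  · obtain ⟨y, hy⟩ := hne
    exact ⟨y, hsub hy, hy⟩
  · intro y hy hyf
    exact absurd (mem_ball_iff_norm.1 hy) (not_lt.2 (hall y hyf).ge)

end RobinTorsion

theorem mainTheorem7 (N : ℕ) (hN : 2 ≤ N) (Ω : Set (RobinTorsion.Euc N))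
    (hΩo : IsOpen Ω) (hΩc : IsConnected Ω) (hΩb : Bornology.IsBounded Ω)
    (hΩ2 : RobinTorsion.HasC2Boundary Ω)
    (β : ℝ) (hβ : β ≠ 0) (u : RobinTorsion.Euc N → ℝ)
    (hu : RobinTorsion.IsRobinTorsionSolution Ω β u)
    (hνν : ∀ x ∈ frontier Ω,
      inner ℝ (RobinTorsion.hess Ω u x (RobinTorsion.outerNormal Ω x))
        (RobinTorsion.outerNormal Ω x) = 1)
    (hκ : 0 < RobinTorsion.kappaMin Ω + β) :
    ∃ (z : RobinTorsion.Euc N) (R : ℝ), 0 < R ∧ Ω = Metric.ball z R ∧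
      ∃ f : ℝ → ℝ, ∀ x ∈ closure Ω, u x = f (dist x z) := by
  obtain ⟨M, hM⟩ := RobinTorsion.pFunction_eq_const hΩo hΩc hΩb hΩ2 hu hνν hκ
  obtain ⟨z, c, hzc⟩ := RobinTorsion.exists_eq_quadratic_of_pFunction_const hΩo hΩc hΩ2
    hu.contDiffOn hu.laplacian_eq fun x hx => hM x (subset_closure hx)
  obtain ⟨R, hR, hball⟩ := RobinTorsion.eq_ball_of_position_normal (β := β) (c := c) (z := z) hN hΩo
    hΩc.nonempty hΩb hΩ2 hκ
    (fun x hx => by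
      have h := RobinTorsion.grad_eq_smul_normal_of_pFunction_const hΩo hΩb hΩ2 hu hκ hM hx
        (hνν x hx)
      rwa [(hzc x (frontier_subset_closure hx)).1] at h)
    (fun x hx => by
      have h := hu.robin x hx
      rwa [(hzc x (frontier_subset_closure hx)).1, (hzc x (frontier_subset_closure hx)).2] at h)
  refine ⟨z, R, hR, hball, fun r => r ^ 2 / 2 + c, fun x hx => ?_⟩
  rw [(hzc x hx).2, dist_eq_norm]
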